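/- Consider the linear call-by-value $\lambda$-calculus $\ell\mathit{PST}_\lambda$ with types $A,B::=\mathtt{bool}\mid A\multimap B\mid A\otimes B$, terms $$e,f,g::=v\mid ef\mid \mathtt{if}\ e\ \mathtt{then}\ f\ \mathtt{else}\ g\mid \mathtt{let}\ e\ \mathtt{be}\ \langle x,y\rangle\ \mathtt{in}\ f\mid\Omega\mid e\oplus f$$ and values $v,w::=x\mid\mathtt{tt}\mid\mathtt{ff}\mid\lambda x.e\mid\langle v,w\rangle$. Typing judgments $\Gamma\vdash e:A$ (with $\Gamma$ a finite set of assignments of types to variables) are linear: variables are typed by $x:A\vdash x:A$, the booleans by $\vdash b:\mathtt{bool}$, $\lambda$ by $\Gamma,x:A\vdash e:B\Rightarrow\Gamma\vdash\lambda x.e:A\multimap B$, and $\Gamma\vdash\Omega:A$ always holds; application, pairing, $\mathtt{let}$ and $\mathtt{if}$ split the context into disjoint parts (the two branches of $\mathtt{if}$ share one part). For $e\oplus f$, fix either one of the two rules: $e$ and $f$ share the context ($\Gamma\vdash e:A$ and $\Gamma\vdash f:A$ give $\Gamma\vdash e\oplus f:A$), or they split it ($\Gamma\vdash e:A$ and $\Delta\vdash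 f:A$ give $\Gamma,\Delta\vdash e\oplus f:A$); the statement below holds for each of the two choices. Evaluation $e\Downarrow\mathscr{E}$ relates closed terms to finitely supported subdistributions of values: $v\Downarrow\{v^1\}$; $\Omega\Downarrow\emptyset$; if $e\Downarrow\mathscr{E}$, $f\Downarrow\mathscr{F}$ and $g\Downarrow\mathscr{G}$, then $e\oplus f\Downarrow\frac12\mathscr{E}+\frac12\mathscr{F}$ and $\mathtt{if}\ e\ \mathtt{then}\ f\ \mathtt{else}\ g\Downarrow\mathscr{E}(\mathtt{tt})\mathscr{F}+\mathscr{E}(\mathtt{ff})\mathscr{G}$; if $e\Downarrow\mathscr{E}$, $f\Downarrow\mathscr{F}$ and $s\{w/x\}\Downarrow\mathscr{G}_{s,w}$ for all $\lambda x.s$ in the support of $\mathscr{E}$ and $w$ in that of $\mathscr{F}$, then $ef\Downarrow\sum\mathscr{E}(\lambda x.s)\mathscr{F}(w)\mathscr{G}_{s,w}$; if $e\Downarrow\mathscr{E}$ and $f\{v/x,w/y\}\Downarrow\mathscr{G}_{v,w}$ for all $\langle v,w\rangle$ in the support of $\mathscr{E}$, then $\mathtt{let}\ e\ \mathtt{be}\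 \langle x,y\rangle\ \mathtt{in}\ f\Downarrow\sum\mathscr{E}(\langle v,w\rangle)\mathscr{G}_{v,w}$. The unique $\mathscr{E}$ with $e\Downarrow\mathscr{E}$ is written $[\![e]\!]$, and $\sum_v[\![e]\!](v)$ is the probability of convergence of $e$. Context preorder: for $\Gamma\vdash e,f:A$, write $e\leq_{\Gamma,A}f$ if for every type $B$ and every context $C$ (a term with exactly one hole, which stands for a term and may lie in the scope of binders) that, by the typing rules, yields a closed term of type $B$ when its hole is filled with terms of type $A$ in $\Gamma$, the probability of convergence of $C[e]$ is at most that of $C[f]$. Context equivalence $\equiv_{\Gamma,A}$ is $\leq_{\Gamma,A}\cap\geq_{\Gamma,A}$. Applicative (bi)similarity: consider the labelled Markov chain with states the pairs $(e,A)$ for closed terms $\vdash e:A$ and, as a disjoint copy for values, the pairs $(\hat v,A)$ for closed values $\vdash v:A$, and with transition probabilities $P((e,A),\mathit{eval},(\hat v,A))=[\![e]\!](v)$; $P((\hat b,\mathtt{bool}),b,(\hat b,\mathtt{bool}))=1$ for $b\in\{\mathtt{tt},\mathtt{ff}\}$; $P((\widehat{\lambda x.e},A\multimap B),(v,A),(e\{v/x\},B))=1$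 for closed values $v$ of type $A$; $P((\widehat{\langle v,w\rangle},A\otimes B),(e,(A,B,E)),(e\{v/x,w/y\},E))=1$ for terms $x:A,y:B\vdash e:E$; $P((e,A),A,(e,A))=1$ and $P((\hat v,A),\hat A,(\hat v,A))=1$, where the types $A$ and their copies $\hat A$ are labels; and $P=0$ in all other cases. With $P(s,\ell,X)=\sum_{t\in X}P(s,\ell,t)$, a simulation is a preorder $R$ on states such that $s\,R\,t$ implies $P(s,\ell,X)\leq P(t,\ell,R(X))$ for every label $\ell$ and every set $X$ of states; a bisimulation is an equivalence $R$ such that $s\,R\,t$ implies $P(s,\ell,X)=P(t,\ell,X)$ for every label $\ell$ and every equivalence class $X$ of $R$. Similarity $\preceq$ and bisimilarity $\sim$ are the largest simulation and bisimulation. For $\Gamma\vdash e,f:A$, write $e\preceq_{\Gamma,A}f$ (respectively $e\sim_{\Gamma,A}f$) if, for every substitution of closed values of the right types for the variables of $\Gamma$, the resulting closed terms are related by $\preceq$ (respectively $\sim$) as term states of type $A$. Theorem. For every finite typing context $\Gamma$, every type $A$ and all $e,f$ with $\Gamma\vdash e:A$ and $\Gamma\vdash f:A$: if $e\preceq_{\Gamma,A}f$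 then $e\leq_{\Gamma,A}f$; consequently, if $e\sim_{\Gamma,A}f$ then $e\equiv_{\Gamma,A}f$. -/

import Mathlib

open scoped NNReal ENNReal

namespace LPST

/-! ### Types, terms and values -/

/-- Types `A, B ::= bool | A ⊸ B | A ⊗ B`. -/
inductive Ty : Type where
  | bool : Ty
  | lolli (A B : Ty) : Ty
  | tensor (A B : Ty) : Ty

/-- The two syntactic categories. -/
inductive Kind : Type where
  | term
  | value

/-- Terms and values, up to renaming of bound variables: variables are de Bruijn indices.
`lam` binds index `0`. In `letp e f` (that is, `let e be ⟨x, y⟩ in f`) the term `f` sees `x` as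
index `1` and `y` as index `0`. `ret` is the inclusion of values into terms. -/
inductive Tm : Kind → Type where
  | var (n : ℕ) : Tm .value
  | bool (b : Bool) : Tm .value
  | lam (e : Tm .term) : Tm .value
  | pair (v w : Tm .value) : Tm .value
  | ret (v : Tm .value) : Tm .term
  | app (e f : Tm .term) : Tm .term
  | ite (e f g : Tm .term) : Tm .term
  | letp (e f : Tm .term) : Tm .term
  | omega : Tm .term
  | choice (e f : Tm .term) : Tm .term

abbrev Trm : Type := Tm .term
abbrev Val : Type := Tm .value

/-! ### Substitution -/

/-- A renaming, pushed under one binder. -/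
def liftRen (ρ : ℕ → ℕ) : ℕ → ℕ
  | 0 => 0
  | n + 1 => ρ n + 1

def Tm.rename : {k : Kind} → (ℕ → ℕ) → Tm k → Tm k
  | _, ρ, .var n => .var (ρ n)
  | _, _, .bool b => .bool b
  | _, ρ, .lam e => .lam (e.rename (liftRen ρ))
  | _, ρ, .pair v w => .pair (v.rename ρ) (w.rename ρ)
  | _, ρ, .ret v => .ret (v.rename ρ)
  | _, ρ, .app e f => .app (e.rename ρ) (f.rename ρ)
  | _, ρ, .ite e f g => .ite (e.rename ρ) (f.rename ρ) (g.rename ρ)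
  | _, ρ, .letp e f => .letp (e.rename ρ) (f.rename (liftRen (liftRen ρ)))
  | _, _, .omega => .omega
  | _, ρ, .choice e f => .choice (e.rename ρ) (f.rename ρ)

/-- A substitution of values for variables, pushed under one binder. -/
def liftSub (σ : ℕ → Val) : ℕ → Val
  | 0 => .var 0
  | n + 1 => (σ n).rename Nat.succ

/-- Simultaneous capture-avoiding substitution of values for variables. -/
def Tm.subst : {k : Kind} → (ℕ → Val) → Tm k → Tm k
  | _, σ, .var n => σ n
  | _, _, .bool b => .bool b
  | _, σ, .lam e => .lam (e.subst (liftSub σ))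
  | _, σ, .pair v w => .pair (v.subst σ) (w.subst σ)
  | _, σ, .ret v => .ret (v.subst σ)
  | _, σ, .app e f => .app (e.subst σ) (f.subst σ)
  | _, σ, .ite e f g => .ite (e.subst σ) (f.subst σ) (g.subst σ)
  | _, σ, .letp e f => .letp (e.subst σ) (f.subst (liftSub (liftSub σ)))
  | _, _, .omega => .omega
  | _, σ, .choice e f => .choice (e.subst σ) (f.subst σ)

/-- `consSub v σ` sends index `0` to `v` and index `n + 1` to `σ n`. -/
def consSub (v : Val) (σ : ℕ → Val) : ℕ → Val
  | 0 => v
  | n + 1 => σ n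

/-- `e{v/x}`, where `x` is index `0` of `e`. -/
def Tm.subst1 (e : Trm) (v : Val) : Trm := e.subst (consSub v Tm.var)

/-- `e{v/x, w/y}`, where `x` is index `1` and `y` is index `0` of `e`. -/
def Tm.subst2 (e : Trm) (v w : Val) : Trm := e.subst (consSub w (consSub v Tm.var))

/-! ### Typing -/

/-- Sets of assignments of types to variables, as partial functions; only finite ones occur in
derivable judgments (see the rule for `omega`). -/
def TyCtx : Type := ℕ → Option Ty

def TyCtx.empty : TyCtx := fun _ => none

/-- The typing context `x : A`, where `x` is index `n`. -/
def TyCtx.single (n : ℕ) (A : Ty) : TyCtx := fun m => if m = n then some A else none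

/-- `Γ, x : A`, seen from under a binder for `x`. -/
def TyCtx.cons (A : Ty) (Γ : TyCtx) : TyCtx
  | 0 => some A
  | n + 1 => Γ n

def TyCtx.dom (Γ : TyCtx) : Set ℕ := {n | Γ n ≠ none}

/-- `Γ = Γ₁, Γ₂`: the context `Γ` is the union of `Γ₁` and `Γ₂`, whose domains are disjoint. -/
def TyCtx.Split (Γ Γ₁ Γ₂ : TyCtx) : Prop :=
  ∀ n, (Γ₁ n = none ∧ Γ₂ n = Γ n) ∨ (Γ₂ n = none ∧ Γ₁ n = Γ n)

/-- The two linear typing disciplines for the operands of `e ⊕ f`. -/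
inductive ChoiceRule : Type where
  /-- from `Γ ⊢ e : A` and `Γ ⊢ f : A` derive `Γ ⊢ e ⊕ f : A` -/
  | additive
  /-- from `Γ ⊢ e : A` and `Δ ⊢ f : A` derive `Γ, Δ ⊢ e ⊕ f : A` -/
  | multiplicative

/-- How the context of `e ⊕ f` is obtained from the contexts of `e` and of `f`. -/
def ChoiceRule.Splits : ChoiceRule → TyCtx → TyCtx → TyCtx → Prop
  | .additive, Γ, Γ₁, Γ₂ => Γ₁ = Γ ∧ Γ₂ = Γ
  | .multiplicative, Γ, Γ₁, Γ₂ => Γ.Split Γ₁ Γ₂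

/-- The typing judgment `Γ ⊢ e : A`, for terms and for values. -/
inductive HasType (r : ChoiceRule) : {k : Kind} → TyCtx → Tm k → Ty → Prop where
  | var {Γ : TyCtx} {n : ℕ} {A : Ty} (hΓ : Γ = TyCtx.single n A) : HasType r Γ (.var n) A
  | bool {Γ : TyCtx} {b : Bool} (hΓ : Γ = TyCtx.empty) : HasType r Γ (.bool b) .bool
  | lam {Γ : TyCtx} {e : Trm} {A B : Ty} (he : HasType r (Γ.cons A) e B) :
      HasType r Γ (.lam e) (.lolli A B)
  | pair {Γ Γ₁ Γ₂ : TyCtx} {v w : Val} {A B : Ty} (hΓ : Γ.Split Γ₁ Γ₂)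
      (hv : HasType r Γ₁ v A) (hw : HasType r Γ₂ w B) : HasType r Γ (.pair v w) (.tensor A B)
  | ret {Γ : TyCtx} {v : Val} {A : Ty} (hv : HasType r Γ v A) : HasType r Γ (.ret v) A
  | app {Γ Γ₁ Γ₂ : TyCtx} {e f : Trm} {A B : Ty} (hΓ : Γ.Split Γ₁ Γ₂)
      (he : HasType r Γ₁ e (.lolli A B)) (hf : HasType r Γ₂ f A) : HasType r Γ (.app e f) B
  | ite {Γ Γ₁ Γ₂ : TyCtx} {e f g : Trm} {A : Ty} (hΓ : Γ.Split Γ₁ Γ₂)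
      (he : HasType r Γ₁ e .bool) (hf : HasType r Γ₂ f A) (hg : HasType r Γ₂ g A) :
      HasType r Γ (.ite e f g) A
  | letp {Γ Γ₁ Γ₂ : TyCtx} {e f : Trm} {A X Y : Ty} (hΓ : Γ.Split Γ₁ Γ₂)
      (hf : HasType r ((Γ₁.cons X).cons Y) f A) (he : HasType r Γ₂ e (.tensor X Y)) :
      HasType r Γ (.letp e f) A
  | omega {Γ : TyCtx} {A : Ty} (hΓ : Γ.dom.Finite) : HasType r Γ .omega A
  | choice {Γ Γ₁ Γ₂ : TyCtx} {e f : Trm} {A : Ty} (hΓ : r.Splits Γ Γ₁ Γ₂)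
      (he : HasType r Γ₁ e A) (hf : HasType r Γ₂ f A) : HasType r Γ (.choice e f) A

/-! ### Big-step semantics -/

/-- Finitely supported `ℝ≥0`-valued functions on values; those reached by evaluation have total
mass at most one (`BigStep.mass_le_one`). -/
abbrev Dist : Type := Val →₀ ℝ≥0

/-- The total mass of a distribution. -/
noncomputable def Dist.mass (E : Dist) : ℝ≥0 := E.sum fun _ p => p

/-- `∑ E(λx.s) F(w) G(s, w)`, over `λx.s` in the support of `E` and `w` in the support of `F`. -/
noncomputable def appDist (E F : Dist) (G : Trm → Val → Dist) : Dist :=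
  E.sum fun u p =>
    match u with
    | .lam s => F.sum fun w q => (p * q) • G s w
    | _ => 0

/-- `∑ E(⟨v, w⟩) G(v, w)`, over `⟨v, w⟩` in the support of `E`. -/
noncomputable def letDist (E : Dist) (G : Val → Val → Dist) : Dist :=
  E.sum fun u p =>
    match u with
    | .pair v w => p • G v w
    | _ => 0

/-- The evaluation relation `e ⇓ E` between terms and distributions of values. -/
inductive BigStep : Trm → Dist → Prop where
  | ret (v : Val) : BigStep (.ret v) (Finsupp.single v 1)
  | omega : BigStep .omega 0
  | app {e f : Trm} {E F : Dist} {G : Trm → Val → Dist} (he : BigStep e E) (hf : BigStep f F)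
      (hG : ∀ s w, Tm.lam s ∈ E.support → w ∈ F.support → BigStep (s.subst1 w) (G s w)) :
      BigStep (.app e f) (appDist E F G)
  | ite {e f g : Trm} {E F G : Dist} (he : BigStep e E) (hf : BigStep f F) (hg : BigStep g G) :
      BigStep (.ite e f g) (E (.bool true) • F + E (.bool false) • G)
  | letp {e f : Trm} {E : Dist} {G : Val → Val → Dist} (he : BigStep e E)
      (hG : ∀ v w, Tm.pair v w ∈ E.support → BigStep (f.subst2 v w) (G v w)) :
      BigStep (.letp e f) (letDist E G)
  | choice {e f : Trm} {E F : Dist} (he : BigStep e E) (hf : BigStep f F) :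
      BigStep (.choice e f) ((2⁻¹ : ℝ≥0) • E + (2⁻¹ : ℝ≥0) • F)

open Classical in
/-- The semantics `⟦e⟧` of `e`: the distribution `E` with `e ⇓ E` (it exists and is unique for
closed typable terms). -/
noncomputable def sem (e : Trm) : Dist := if h : ∃ E, BigStep e E then h.choose else 0

/-- The probability that `e` converges. -/
noncomputable def probConv (e : Trm) : ℝ≥0 := (sem e).mass

theorem Dist.mass_add (E F : Dist) : (E + F).mass = E.mass + F.mass :=
  Finsupp.sum_add_index' (fun _ => rfl) (fun _ _ _ => rfl)

theorem Dist.mass_smul (c : ℝ≥0) (E : Dist) : Dist.mass (c • E) = c * E.mass := by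
  unfold Dist.mass
  rw [Finsupp.sum_smul_index (fun _ => rfl), Finsupp.sum, Finsupp.sum, Finset.mul_sum]

theorem Dist.mass_finset_sum {ι : Type} (s : Finset ι) (g : ι → Dist) :
    Dist.mass (∑ i ∈ s, g i) = ∑ i ∈ s, (g i).mass := by
  classical
  induction s using Finset.induction_on with
  | empty => rfl
  | insert a s ha ih => rw [Finset.sum_insert ha, Finset.sum_insert ha, Dist.mass_add, ih]

theorem Dist.le_one_of_mass {E : Dist} (h : E.mass ≤ 1) (v : Val) : E v ≤ 1 := by
  by_cases hv : v ∈ E.support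
  · exact (Finset.single_le_sum (f := fun v => E v) (fun _ _ => zero_le) hv).trans h
  · simp [Finsupp.notMem_support_iff.1 hv]

theorem BigStep.mass_le_one {e : Trm} {E : Dist} (h : BigStep e E) : E.mass ≤ 1 := by
  induction h with
  | ret v => simp [Dist.mass]
  | omega => simp [Dist.mass]
  | @app e f E F G _ _ _ ihE ihF ihG =>
    unfold appDist
    rw [Finsupp.sum, Dist.mass_finset_sum]
    refine le_trans (Finset.sum_le_sum (g := fun u => E u) ?_) ihE
    intro u hu
    cases u with
    | lam s =>
      show Dist.mass (F.sum fun w q => (E (Tm.lam s) * q) • G s w) ≤ _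
      rw [Finsupp.sum, Dist.mass_finset_sum]
      calc ∑ w ∈ F.support, Dist.mass ((E (Tm.lam s) * F w) • G s w)
          ≤ ∑ w ∈ F.support, E (Tm.lam s) * F w := by
            refine Finset.sum_le_sum fun w hw => ?_
            rw [Dist.mass_smul]
            exact mul_le_of_le_one_right (zero_le) (ihG s w hu hw)
        _ = E (Tm.lam s) * F.mass := by rw [← Finset.mul_sum]; rfl
        _ ≤ E (Tm.lam s) := mul_le_of_le_one_right (zero_le) ihF
    | var n => simp [Dist.mass]
    | bool b => simp [Dist.mass]
    | pair v w => simp [Dist.mass]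
  | @ite e f g E F G _ _ _ ihE ihF ihG =>
    rw [Dist.mass_add, Dist.mass_smul, Dist.mass_smul]
    refine le_trans (add_le_add (mul_le_of_le_one_right (zero_le) ihF)
      (mul_le_of_le_one_right (zero_le) ihG)) (le_trans ?_ ihE)
    classical
    have hne : (Tm.bool true : Val) ≠ Tm.bool false := by simp
    rw [← Finset.sum_pair (f := fun v => E v) hne]
    unfold Dist.mass Finsupp.sum
    rw [← Finset.sum_filter_of_ne (s := {Tm.bool true, Tm.bool false})
      (p := fun v => v ∈ E.support) (fun v _ hv => Finsupp.mem_support_iff.2 hv)]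
    exact Finset.sum_le_sum_of_subset (fun v hv => (Finset.mem_filter.1 hv).2)
  | @letp e f E G _ _ ihE ihG =>
    unfold letDist
    rw [Finsupp.sum, Dist.mass_finset_sum]
    refine le_trans (Finset.sum_le_sum (g := fun u => E u) ?_) ihE
    intro u hu
    cases u with
    | pair v w =>
      show Dist.mass (E (Tm.pair v w) • G v w) ≤ _
      rw [Dist.mass_smul]
      exact mul_le_of_le_one_right (zero_le) (ihG v w hu)
    | var n => simp [Dist.mass]
    | bool b => simp [Dist.mass]
    | lam e => simp [Dist.mass]
  | @choice e f E F _ _ ihE ihF =>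
    rw [Dist.mass_add, Dist.mass_smul, Dist.mass_smul]
    refine le_trans (add_le_add (mul_le_of_le_one_right (zero_le) ihE)
      (mul_le_of_le_one_right (zero_le) ihF)) (le_of_eq ?_)
    rw [← two_mul]
    exact mul_inv_cancel₀ two_ne_zero

theorem sem_mass_le_one (e : Trm) : (sem e).mass ≤ 1 := by
  unfold sem
  split_ifs with h
  · exact h.choose_spec.mass_le_one
  · simp [Dist.mass]

/-! ### Contexts and the context preorder -/

/-- Contexts: terms, or values, with exactly one occurrence of a hole that stands for a term.
Filling may capture variables. As bound variables have no names, the hole records which variable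
in scope at the hole each free variable `n` of the plugged term becomes, namely `ρ n`. -/
inductive Context : Kind → Type where
  | hole (ρ : ℕ → ℕ) : Context .term
  | lam (C : Context .term) : Context .value
  | pairL (C : Context .value) (w : Val) : Context .value
  | pairR (v : Val) (C : Context .value) : Context .value
  | ret (C : Context .value) : Context .term
  | appL (C : Context .term) (f : Trm) : Context .term
  | appR (e : Trm) (C : Context .term) : Context .term
  | iteC (C : Context .term) (f g : Trm) : Context .term
  | iteT (e : Trm) (C : Context .term) (g : Trm) : Context .term
  | iteF (e f : Trm) (C : Context .term) : Context .term
  | letL (C : Context .term) (f : Trm) : Context .term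
  | letR (e : Trm) (C : Context .term) : Context .term
  | choiceL (C : Context .term) (f : Trm) : Context .term
  | choiceR (e : Trm) (C : Context .term) : Context .term

/-- `C[e]`. -/
def Context.fill : {k : Kind} → Context k → Trm → Tm k
  | _, .hole ρ, t => t.rename ρ
  | _, .lam C, t => .lam (C.fill t)
  | _, .pairL C w, t => .pair (C.fill t) w
  | _, .pairR v C, t => .pair v (C.fill t)
  | _, .ret C, t => .ret (C.fill t)
  | _, .appL C f, t => .app (C.fill t) f
  | _, .appR e C, t => .app e (C.fill t)
  | _, .iteC C f g, t => .ite (C.fill t) f g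
  | _, .iteT e C g, t => .ite e (C.fill t) g
  | _, .iteF e f C, t => .ite e f (C.fill t)
  | _, .letL C f, t => .letp (C.fill t) f
  | _, .letR e C, t => .letp e (C.fill t)
  | _, .choiceL C f, t => .choice (C.fill t) f
  | _, .choiceR e C, t => .choice e (C.fill t)

/-- `ρ` is a bijection from the variables of `Δ` to those of `Γ` that preserves types: up to the
renaming `ρ`, the typing contexts `Δ` and `Γ` are the same. -/
def TyCtx.Renames (ρ : ℕ → ℕ) (Δ Γ : TyCtx) : Prop :=
  (∀ n A, Δ n = some A → Γ (ρ n) = some A) ∧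
    (∀ m A, Γ m = some A → ∃ n, Δ n = some A ∧ ρ n = m) ∧ Set.InjOn ρ Δ.dom

/-- The typing judgment `Γ ⊢ C(Δ; A) : B` for contexts: the hole of `C` is to be filled with terms
of type `A` in `Δ`, and the result then has type `B` in `Γ`. -/
inductive CtxHasType (r : ChoiceRule) (Δ : TyCtx) (A : Ty) :
    {k : Kind} → TyCtx → Context k → Ty → Prop where
  | hole {Γ : TyCtx} {ρ : ℕ → ℕ} (hΓ : TyCtx.Renames ρ Δ Γ) : CtxHasType r Δ A Γ (.hole ρ) A
  | lam {Γ : TyCtx} {C : Context .term} {X Y : Ty} (hC : CtxHasType r Δ A (Γ.cons X) C Y) :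
      CtxHasType r Δ A Γ (.lam C) (.lolli X Y)
  | pairL {Γ Γ₁ Γ₂ : TyCtx} {C : Context .value} {w : Val} {X Y : Ty} (hΓ : Γ.Split Γ₁ Γ₂)
      (hC : CtxHasType r Δ A Γ₁ C X) (hw : HasType r Γ₂ w Y) :
      CtxHasType r Δ A Γ (.pairL C w) (.tensor X Y)
  | pairR {Γ Γ₁ Γ₂ : TyCtx} {v : Val} {C : Context .value} {X Y : Ty} (hΓ : Γ.Split Γ₁ Γ₂)
      (hv : HasType r Γ₁ v X) (hC : CtxHasType r Δ A Γ₂ C Y) :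
      CtxHasType r Δ A Γ (.pairR v C) (.tensor X Y)
  | ret {Γ : TyCtx} {C : Context .value} {X : Ty} (hC : CtxHasType r Δ A Γ C X) :
      CtxHasType r Δ A Γ (.ret C) X
  | appL {Γ Γ₁ Γ₂ : TyCtx} {C : Context .term} {f : Trm} {X Y : Ty} (hΓ : Γ.Split Γ₁ Γ₂)
      (hC : CtxHasType r Δ A Γ₁ C (.lolli X Y)) (hf : HasType r Γ₂ f X) :
      CtxHasType r Δ A Γ (.appL C f) Y
  | appR {Γ Γ₁ Γ₂ : TyCtx} {e : Trm} {C : Context .term} {X Y : Ty} (hΓ : Γ.Split Γ₁ Γ₂)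
      (he : HasType r Γ₁ e (.lolli X Y)) (hC : CtxHasType r Δ A Γ₂ C X) :
      CtxHasType r Δ A Γ (.appR e C) Y
  | iteC {Γ Γ₁ Γ₂ : TyCtx} {C : Context .term} {f g : Trm} {X : Ty} (hΓ : Γ.Split Γ₁ Γ₂)
      (hC : CtxHasType r Δ A Γ₁ C .bool) (hf : HasType r Γ₂ f X) (hg : HasType r Γ₂ g X) :
      CtxHasType r Δ A Γ (.iteC C f g) X
  | iteT {Γ Γ₁ Γ₂ : TyCtx} {e : Trm} {C : Context .term} {g : Trm} {X : Ty}
      (hΓ : Γ.Split Γ₁ Γ₂) (he : HasType r Γ₁ e .bool) (hC : CtxHasType r Δ A Γ₂ C X)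
      (hg : HasType r Γ₂ g X) : CtxHasType r Δ A Γ (.iteT e C g) X
  | iteF {Γ Γ₁ Γ₂ : TyCtx} {e f : Trm} {C : Context .term} {X : Ty}
      (hΓ : Γ.Split Γ₁ Γ₂) (he : HasType r Γ₁ e .bool) (hf : HasType r Γ₂ f X)
      (hC : CtxHasType r Δ A Γ₂ C X) : CtxHasType r Δ A Γ (.iteF e f C) X
  | letL {Γ Γ₁ Γ₂ : TyCtx} {C : Context .term} {f : Trm} {X Y Z : Ty} (hΓ : Γ.Split Γ₁ Γ₂)
      (hf : HasType r ((Γ₁.cons X).cons Y) f Z) (hC : CtxHasType r Δ A Γ₂ C (.tensor X Y)) :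
      CtxHasType r Δ A Γ (.letL C f) Z
  | letR {Γ Γ₁ Γ₂ : TyCtx} {e : Trm} {C : Context .term} {X Y Z : Ty} (hΓ : Γ.Split Γ₁ Γ₂)
      (hC : CtxHasType r Δ A ((Γ₁.cons X).cons Y) C Z) (he : HasType r Γ₂ e (.tensor X Y)) :
      CtxHasType r Δ A Γ (.letR e C) Z
  | choiceL {Γ Γ₁ Γ₂ : TyCtx} {C : Context .term} {f : Trm} {X : Ty} (hΓ : r.Splits Γ Γ₁ Γ₂)
      (hC : CtxHasType r Δ A Γ₁ C X) (hf : HasType r Γ₂ f X) :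
      CtxHasType r Δ A Γ (.choiceL C f) X
  | choiceR {Γ Γ₁ Γ₂ : TyCtx} {e : Trm} {C : Context .term} {X : Ty} (hΓ : r.Splits Γ Γ₁ Γ₂)
      (he : HasType r Γ₁ e X) (hC : CtxHasType r Δ A Γ₂ C X) :
      CtxHasType r Δ A Γ (.choiceR e C) X

/-- The context preorder at typing context `Γ` and type `A`. -/
def CtxPreorder (r : ChoiceRule) (Γ : TyCtx) (A : Ty) (e f : Trm) : Prop :=
  ∀ (C : Context .term) (B : Ty), CtxHasType r Γ A TyCtx.empty C B →
    probConv (C.fill e) ≤ probConv (C.fill f)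

/-- Context equivalence at typing context `Γ` and type `A`. -/
def CtxEquiv (r : ChoiceRule) (Γ : TyCtx) (A : Ty) (e f : Trm) : Prop :=
  CtxPreorder r Γ A e f ∧ CtxPreorder r Γ A f e

/-! ### Labelled Markov chains -/

/-- Labelled Markov chains with state set `S` and label set `L`. -/
structure LMC (S L : Type) where
  prob : S → L → S → ℝ≥0∞
  sum_le_one : ∀ s l, ∑' t, prob s l t ≤ 1

namespace LMC

variable {S L : Type}

/-- `P(s, l, X)`, the sum of `P(s, l, t)` over `t ∈ X`. -/
noncomputable def probSet (M : LMC S L) (s : S) (l : L) (X : Set S) : ℝ≥0∞ :=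
  ∑' t : X, M.prob s l t

/-- Simulations: preorders `R` with `P(s, l, X) ≤ P(t, l, R(X))` whenever `s R t`. -/
def IsSimulation (M : LMC S L) (R : S → S → Prop) : Prop :=
  (∀ s, R s s) ∧ (∀ s t u, R s t → R t u → R s u) ∧
    ∀ s t, R s t → ∀ (l : L) (X : Set S), M.probSet s l X ≤ M.probSet t l {u | ∃ x ∈ X, R x u}

/-- Bisimulations: equivalences `R` with `P(s, l, E) = P(t, l, E)` whenever `s R t`, for every
equivalence class `E` of `R`. -/
def IsBisimulation (M : LMC S L) (R : S → S → Prop) : Prop :=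
  Equivalence R ∧
    ∀ s t, R s t → ∀ (l : L) (x : S), M.probSet s l {u | R x u} = M.probSet t l {u | R x u}

/-- Similarity: the union of all simulations. -/
def Similar (M : LMC S L) (s t : S) : Prop := ∃ R, M.IsSimulation R ∧ R s t

/-- Bisimilarity: the union of all bisimulations. -/
def Bisimilar (M : LMC S L) (s t : S) : Prop := ∃ R, M.IsBisimulation R ∧ R s t

end LMC

/-! ### The labelled Markov chain of the calculus -/

/-- States: closed typed terms and (distinguished) closed typed values. -/
inductive State (r : ChoiceRule) : Type where
  | tm (e : Trm) (A : Ty) (h : HasType r TyCtx.empty e A) : State r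
  | val (v : Val) (A : Ty) (h : HasType r TyCtx.empty v A) : State r

/-- Labels: terms `x : A, y : B ⊢ e : C`, closed values, `eval`, the two booleans, and two copies
of the types. -/
inductive Label (r : ChoiceRule) : Type where
  | test (e : Trm) (A B C : Ty) (h : HasType r ((TyCtx.empty.cons A).cons B) e C) : Label r
  | arg (v : Val) (A : Ty) (h : HasType r TyCtx.empty v A) : Label r
  | eval : Label r
  | bool (b : Bool) : Label r
  | tyTm (A : Ty) : Label r
  | tyVal (A : Ty) : Label r

/-- The transitions of probability one, for all labels other than `eval`. -/
inductive Fires (r : ChoiceRule) : State r → Label r → State r → Prop where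
  | bool (b : Bool) (h : HasType r TyCtx.empty (.bool b) .bool) :
      Fires r (.val (.bool b) .bool h) (.bool b) (.val (.bool b) .bool h)
  | lam (e : Trm) (v : Val) (A B : Ty) (h : HasType r TyCtx.empty (.lam e) (.lolli A B))
      (hv : HasType r TyCtx.empty v A) (h' : HasType r TyCtx.empty (e.subst1 v) B) :
      Fires r (.val (.lam e) (.lolli A B) h) (.arg v A hv) (.tm (e.subst1 v) B h')
  | pair (v w : Val) (e : Trm) (A B C : Ty)
      (h : HasType r TyCtx.empty (.pair v w) (.tensor A B))
      (he : HasType r ((TyCtx.empty.cons A).cons B) e C)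
      (h' : HasType r TyCtx.empty (e.subst2 v w) C) :
      Fires r (.val (.pair v w) (.tensor A B) h) (.test e A B C he) (.tm (e.subst2 v w) C h')
  | tyTm (e : Trm) (A : Ty) (h : HasType r TyCtx.empty e A) :
      Fires r (.tm e A h) (.tyTm A) (.tm e A h)
  | tyVal (v : Val) (A : Ty) (h : HasType r TyCtx.empty v A) :
      Fires r (.val v A h) (.tyVal A) (.val v A h)

open Classical in
/-- The transition probability matrix: `P((e, A), eval, (v, A)) = ⟦e⟧(v)`, the transitions of
`Fires` have probability one, and all the others have probability zero. -/
noncomputable def transProb (r : ChoiceRule) : State r → Label r → State r → ℝ≥0∞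
  | .tm e A _, .eval, .val v B _ => if A = B then (sem e v : ℝ≥0∞) else 0
  | s, l, t => if Fires r s l t then 1 else 0

theorem Fires.unique {r : ChoiceRule} {s t t' : State r} {l : Label r}
    (h : Fires r s l t) (h' : Fires r s l t') : t = t' := by
  cases h <;> cases h' <;> rfl

theorem transProb_sum_le_one (r : ChoiceRule) (s : State r) (l : Label r) :
    ∑' t, transProb r s l t ≤ 1 := by
  classical
  by_cases hs : ∃ e A h, s = .tm e A h ∧ l = .eval
  · obtain ⟨e, A, h, rfl, rfl⟩ := hs
    have hsupp : Function.support (transProb r (.tm e A h) .eval) ⊆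
        {t | ∃ v hv, t = State.val v A hv} := by
      intro t ht
      cases t with
      | tm f B hf =>
        exact absurd (show transProb r (.tm e A h) .eval (.tm f B hf) = 0 from
          if_neg (fun hF => by cases hF)) ht
      | val v B hv =>
        by_cases hAB : A = B
        · subst hAB
          exact ⟨v, hv, rfl⟩
        · exact absurd (show transProb r (.tm e A h) .eval (.val v B hv) = 0 from
            if_neg hAB) ht
    rw [← tsum_subtype_eq_of_support_subset hsupp]
    let g : {t : State r | ∃ v hv, t = State.val v A hv} → Val := fun t => t.2.choose
    have hg : ∀ t, ∃ hv, t.1 = State.val (g t) A hv := fun t => t.2.choose_spec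
    have hinj : Function.Injective g := by
      intro t t' htt
      obtain ⟨h1, e1⟩ := hg t
      obtain ⟨h2, e2⟩ := hg t'
      apply Subtype.ext
      rw [e1, e2]
      congr
    calc ∑' t : {t : State r | ∃ v hv, t = State.val v A hv}, transProb r (.tm e A h) .eval t
        = ∑' t : {t : State r | ∃ v hv, t = State.val v A hv},
            (fun v => (sem e v : ℝ≥0∞)) (g t) := by
          refine tsum_congr fun t => ?_
          obtain ⟨h1, e1⟩ := hg t
          rw [e1]
          exact if_pos rfl
      _ ≤ ∑' v, (sem e v : ℝ≥0∞) := ENNReal.tsum_comp_le_tsum_of_injective hinj _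
      _ = ∑ v ∈ (sem e).support, (sem e v : ℝ≥0∞) :=
          tsum_eq_sum fun v hv => by simpa using hv
      _ = ((sem e).mass : ℝ≥0∞) := by
          unfold Dist.mass Finsupp.sum
          push_cast
          rfl
      _ ≤ 1 := by exact_mod_cast sem_mass_le_one e
  · have hP : ∀ t, transProb r s l t = if Fires r s l t then 1 else 0 := by
      intro t
      unfold transProb
      split
      · exact absurd ⟨_, _, _, rfl, rfl⟩ hs
      · rfl
    by_cases hF : ∃ t, Fires r s l t
    · obtain ⟨t, ht⟩ := hF
      rw [tsum_eq_single t]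
      · rw [hP]
        split_ifs
        exact le_refl _
      · intro t' hne
        rw [hP, if_neg fun h' => hne (h'.unique ht)]
    · rw [ENNReal.tsum_eq_zero.2 fun t => by rw [hP, if_neg fun h => hF ⟨t, h⟩]]
      exact zero_le

/-- The labelled Markov chain of closed typed terms and values. -/
noncomputable def chain (r : ChoiceRule) : LMC (State r) (Label r) where
  prob := transProb r
  sum_le_one := transProb_sum_le_one r

/-! ### Applicative similarity and bisimilarity on open terms -/

/-- `σ` replaces every variable of `Γ` by a closed value of its type. -/
def Closes (r : ChoiceRule) (Γ : TyCtx) (σ : ℕ → Val) : Prop :=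
  ∀ n A, Γ n = some A → HasType r TyCtx.empty (σ n) A

/-- Similarity at typing context `Γ` and type `A`: all closed instances are similar. -/
def AppSim (r : ChoiceRule) (Γ : TyCtx) (A : Ty) (e f : Trm) : Prop :=
  ∀ σ, Closes r Γ σ →
    ∃ (he : HasType r TyCtx.empty (e.subst σ) A) (hf : HasType r TyCtx.empty (f.subst σ) A),
      (chain r).Similar (.tm (e.subst σ) A he) (.tm (f.subst σ) A hf)

/-- Bisimilarity at typing context `Γ` and type `A`: all closed instances are bisimilar. -/
def AppBisim (r : ChoiceRule) (Γ : TyCtx) (A : Ty) (e f : Trm) : Prop :=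
  ∀ σ, Closes r Γ σ →
    ∃ (he : HasType r TyCtx.empty (e.subst σ) A) (hf : HasType r TyCtx.empty (f.subst σ) A),
      (chain r).Bisimilar (.tm (e.subst σ) A he) (.tm (f.subst σ) A hf)

end LPST

/-! Linearity replaces transitivity in the congruence argument. Applications, pairs and `let` split
their context, so a variable belongs to only one component. It therefore suffices to close
similarity under the term formers with a single component of these constructs changing at a time;
this closure is `Rel`. It is stable under linear substitution (`Rel.subst`) and under replacing the
value of one variable by a related value (`Rel.of_diffAt`). If operator and argument could both
change, evaluation would have to compare `s{w/x}` with `s'{w'/x}` through an intermediate term,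
hence would need transitivity, as in Howe's method; this situation never arises here. Conditionals
and choices may change in all components: their components can share variables, and evaluation never
substitutes one component into another.

Distributions are compared by `Dist.Lift`, through expectations of pairs of test functions, one
dominating the other along the relation. This form suits sequencing: evaluation of an application or
a `let` is an iterated expectation, whose inner expectation is a test function for the outer one.
The simulation condition speaks of sets instead; the layer-cake formula converts it
(`Dist.Lift.of_sets`), so that similar terms evaluate to distributions in the lifting of value
similarity (`AppSim.lift_valSim`).

The central result is `Rel.lift`: related closed terms evaluate to distributions in the lifting of
`Rel`. The constant test function one then compares probabilities of convergence. Filling a context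
with similar terms gives related terms (`Rel.fill`), and a reducibility argument shows that closed
typed terms do evaluate, so that `sem` is their semantics. Bisimilarity reduces to similarity in
both directions. -/

namespace LPST

/-! ### The algebra of substitutions -/

theorem liftSub_var : liftSub Tm.var = Tm.var := by
  funext n
  cases n <;> rfl

theorem liftSub_var_comp (ρ : ℕ → ℕ) :
    liftSub (fun n => Tm.var (ρ n)) = fun n => Tm.var (liftRen ρ n) := by
  funext n
  cases n <;> rfl

theorem Tm.rename_eq_subst {k : Kind} (t : Tm k) :
    ∀ ρ : ℕ → ℕ, t.rename ρ = t.subst fun n => .var (ρ n) := by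
  induction t <;> intro ρ <;> simp_all [Tm.rename, Tm.subst, liftSub_var_comp]

theorem Tm.subst_var {k : Kind} (t : Tm k) : t.subst Tm.var = t := by
  induction t <;> simp_all [Tm.subst, liftSub_var]

theorem liftSub_comp_liftRen (σ : ℕ → Val) (ρ : ℕ → ℕ) :
    (fun n => liftSub σ (liftRen ρ n)) = liftSub fun n => σ (ρ n) := by
  funext n
  cases n <;> rfl

/-- Substitution under a binder renames the substituted values, so the composition laws that involve
renamings come before the one for two substitutions: they are what its binder cases need. -/
theorem Tm.subst_rename {k : Kind} (t : Tm k) :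
    ∀ (ρ : ℕ → ℕ) (σ : ℕ → Val), (t.rename ρ).subst σ = t.subst fun n => σ (ρ n) := by
  induction t <;> intro ρ σ <;> simp_all [Tm.rename, Tm.subst, liftSub_comp_liftRen]

theorem Tm.rename_rename {k : Kind} (t : Tm k) (ρ ρ' : ℕ → ℕ) :
    (t.rename ρ).rename ρ' = t.rename fun n => ρ' (ρ n) := by
  rw [Tm.rename_eq_subst _ ρ', Tm.subst_rename, Tm.rename_eq_subst]

theorem rename_liftSub (σ : ℕ → Val) (ρ : ℕ → ℕ) :
    (fun n => (liftSub σ n).rename (liftRen ρ)) = liftSub fun n => (σ n).rename ρ := by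
  funext n
  cases n with
  | zero => rfl
  | succ n => simp [liftSub, Tm.rename_rename, liftRen]

theorem Tm.rename_subst {k : Kind} (t : Tm k) :
    ∀ (σ : ℕ → Val) (ρ : ℕ → ℕ), (t.subst σ).rename ρ = t.subst fun n => (σ n).rename ρ := by
  induction t <;> intro σ ρ <;> simp_all [Tm.rename, Tm.subst, rename_liftSub]

theorem subst_liftSub (σ τ : ℕ → Val) :
    (fun n => (liftSub σ n).subst (liftSub τ)) = liftSub fun n => (σ n).subst τ := by
  funext n
  cases n with
  | zero => rfl
  | succ n => simp [liftSub, Tm.subst_rename, Tm.rename_subst]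

theorem Tm.subst_subst {k : Kind} (t : Tm k) :
    ∀ σ τ : ℕ → Val, (t.subst σ).subst τ = t.subst fun n => (σ n).subst τ := by
  induction t <;> intro σ τ <;> simp_all [Tm.subst, subst_liftSub]

theorem Tm.subst1_liftSub (e : Trm) (σ : ℕ → Val) (v : Val) :
    (e.subst (liftSub σ)).subst1 v = e.subst (consSub v σ) := by
  unfold Tm.subst1
  rw [Tm.subst_subst]
  congr 1
  funext n
  cases n with
  | zero => rfl
  | succ n =>
    simp only [liftSub, consSub, Tm.subst_rename]
    exact Tm.subst_var _

theorem Tm.subst2_liftSub (e : Trm) (σ : ℕ → Val) (v w : Val) :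
    (e.subst (liftSub (liftSub σ))).subst2 v w = e.subst (consSub w (consSub v σ)) := by
  unfold Tm.subst2
  rw [Tm.subst_subst]
  congr 1
  funext n
  rcases n with _ | _ | n
  · rfl
  · rfl
  · simp only [liftSub, consSub, Tm.subst_rename]
    exact Tm.subst_var _

/-! ### Splittings of typing contexts -/

namespace TyCtx

theorem Split.left_eq {Γ Γ₁ Γ₂ : TyCtx} (h : Γ.Split Γ₁ Γ₂) {n : ℕ} {A : Ty}
    (hn : Γ₁ n = some A) : Γ n = some A := by
  rcases h n with ⟨h1, _⟩ | ⟨_, h2⟩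
  · simp [hn] at h1
  · rw [← h2, hn]

theorem Split.symm {Γ Γ₁ Γ₂ : TyCtx} (h : Γ.Split Γ₁ Γ₂) : Γ.Split Γ₂ Γ₁ := fun n => (h n).symm

theorem Split.right_eq {Γ Γ₁ Γ₂ : TyCtx} (h : Γ.Split Γ₁ Γ₂) {n : ℕ} {A : Ty}
    (hn : Γ₂ n = some A) : Γ n = some A := h.symm.left_eq hn

theorem Split.mem_or {Γ Γ₁ Γ₂ : TyCtx} (h : Γ.Split Γ₁ Γ₂) {n : ℕ} {A : Ty}
    (hn : Γ n = some A) : (Γ₁ n = some A ∧ Γ₂ n = none) ∨ (Γ₂ n = some A ∧ Γ₁ n = none) := by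
  rcases h n with ⟨h1, h2⟩ | ⟨h1, h2⟩
  · exact .inr ⟨h2.trans hn, h1⟩
  · exact .inl ⟨h2.trans hn, h1⟩

theorem Split.left_of_empty {Γ₁ Γ₂ : TyCtx} (h : empty.Split Γ₁ Γ₂) : Γ₁ = empty := by
  funext n
  rcases h n with ⟨h1, _⟩ | ⟨_, h2⟩
  · exact h1
  · exact h2

theorem Split.right_of_empty {Γ₁ Γ₂ : TyCtx} (h : empty.Split Γ₁ Γ₂) : Γ₂ = empty :=
  h.symm.left_of_empty

theorem empty_ne_single (n : ℕ) (A : Ty) : empty ≠ single n A := by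
  intro h
  have := congrFun h n
  simp [empty, single] at this

end TyCtx

theorem ChoiceRule.Splits.left_eq {r : ChoiceRule} {Γ Γ₁ Γ₂ : TyCtx} (h : r.Splits Γ Γ₁ Γ₂)
    {n : ℕ} {A : Ty} (hn : Γ₁ n = some A) : Γ n = some A := by
  cases r with
  | additive => rwa [← h.1]
  | multiplicative => exact TyCtx.Split.left_eq h hn

theorem ChoiceRule.Splits.right_eq {r : ChoiceRule} {Γ Γ₁ Γ₂ : TyCtx} (h : r.Splits Γ Γ₁ Γ₂)
    {n : ℕ} {A : Ty} (hn : Γ₂ n = some A) : Γ n = some A := by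
  cases r with
  | additive => rwa [← h.2]
  | multiplicative => exact TyCtx.Split.right_eq h hn

theorem ChoiceRule.Splits.of_empty {r : ChoiceRule} {Γ₁ Γ₂ : TyCtx}
    (h : r.Splits TyCtx.empty Γ₁ Γ₂) : Γ₁ = TyCtx.empty ∧ Γ₂ = TyCtx.empty := by
  cases r with
  | additive => exact h
  | multiplicative => exact ⟨TyCtx.Split.left_of_empty h, TyCtx.Split.right_of_empty h⟩

/-! ### Typed terms depend only on the variables of their context -/

/-- The substitutions `σ` and `τ` agree on the variables of `Γ`. -/
def AgreeOn (Γ : TyCtx) (σ τ : ℕ → Val) : Prop := ∀ n A, Γ n = some A → σ n = τ n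

theorem AgreeOn.lift {Γ : TyCtx} {σ τ : ℕ → Val} (h : AgreeOn Γ σ τ) (X : Ty) :
    AgreeOn (Γ.cons X) (liftSub σ) (liftSub τ) := by
  intro n A hn
  cases n with
  | zero => rfl
  | succ n => exact congrArg _ (h n A hn)

/-- A component whose context misses the changed variable stays literally the same, as the one-sided
rules of `Rel` require. -/
theorem HasType.subst_congr {r : ChoiceRule} {k : Kind} {Γ : TyCtx} {t : Tm k} {A : Ty}
    (ht : HasType r Γ t A) : ∀ {σ τ : ℕ → Val}, AgreeOn Γ σ τ → t.subst σ = t.subst τ := by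
  induction ht with
  | @var Γ n A hΓ =>
    intro σ τ h
    exact h n A (by simp [hΓ, TyCtx.single])
  | bool _ => intros; rfl
  | lam _ ih =>
    intro σ τ h
    simp only [Tm.subst, ih (h.lift _)]
  | pair hΓ _ _ ih₁ ih₂ =>
    intro σ τ h
    simp only [Tm.subst, ih₁ fun n A hn => h n A (hΓ.left_eq hn),
      ih₂ fun n A hn => h n A (hΓ.right_eq hn)]
  | ret _ ih =>
    intro σ τ h
    simp only [Tm.subst, ih h]
  | app hΓ _ _ ih₁ ih₂ =>
    intro σ τ h
    simp only [Tm.subst, ih₁ fun n A hn => h n A (hΓ.left_eq hn),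
      ih₂ fun n A hn => h n A (hΓ.right_eq hn)]
  | ite hΓ _ _ _ ih₁ ih₂ ih₃ =>
    intro σ τ h
    simp only [Tm.subst, ih₁ fun n A hn => h n A (hΓ.left_eq hn),
      ih₂ fun n A hn => h n A (hΓ.right_eq hn), ih₃ fun n A hn => h n A (hΓ.right_eq hn)]
  | @letp Γ Γ₁ Γ₂ e f A X Y hΓ _ _ ih₁ ih₂ =>
    intro σ τ h
    have h₁ : AgreeOn Γ₁ σ τ := fun n A hn => h n A (hΓ.left_eq hn)
    simp only [Tm.subst, ih₁ ((h₁.lift X).lift Y), ih₂ fun n A hn => h n A (hΓ.right_eq hn)]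
  | omega _ => intros; rfl
  | choice hΓ _ _ ih₁ ih₂ =>
    intro σ τ h
    simp only [Tm.subst, ih₁ fun n A hn => h n A (hΓ.left_eq hn),
      ih₂ fun n A hn => h n A (hΓ.right_eq hn)]

theorem HasType.subst_closed {r : ChoiceRule} {k : Kind} {t : Tm k} {A : Ty}
    (ht : HasType r TyCtx.empty t A) (σ : ℕ → Val) : t.subst σ = t := by
  rw [ht.subst_congr (τ := Tm.var) (fun n A hn => by cases hn), Tm.subst_var]

theorem HasType.rename_closed {r : ChoiceRule} {k : Kind} {t : Tm k} {A : Ty}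
    (ht : HasType r TyCtx.empty t A) (ρ : ℕ → ℕ) : t.rename ρ = t := by
  rw [Tm.rename_eq_subst, ht.subst_closed]

/-! ### Linear substitutions -/

/-- `σ` sends each variable of `Γ` to a closed value of its type or to a variable of `Δ`, and every
variable of `Δ` is the image of exactly one variable of `Γ`. -/
structure SubstTy (r : ChoiceRule) (σ : ℕ → Val) (Γ Δ : TyCtx) : Prop where
  maps : ∀ n A, Γ n = some A →
    HasType r TyCtx.empty (σ n) A ∨ ∃ m, σ n = .var m ∧ Δ m = some A
  surj : ∀ m A, Δ m = some A → ∃ n, Γ n = some A ∧ σ n = .var m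
  inj : ∀ n n' m, Γ n ≠ none → Γ n' ≠ none → σ n = .var m → σ n' = .var m → n = n'

theorem not_hasType_empty_var {r : ChoiceRule} {n : ℕ} {A : Ty} :
    ¬ HasType r TyCtx.empty (Tm.var n) A := by
  intro h
  cases h with
  | var hΓ => exact TyCtx.empty_ne_single _ _ hΓ

namespace SubstTy

variable {r : ChoiceRule} {σ : ℕ → Val} {Γ Δ : TyCtx}

theorem lift (h : SubstTy r σ Γ Δ) (X : Ty) :
    SubstTy r (liftSub σ) (Γ.cons X) (Δ.cons X) where
  maps n A hn := by
    cases n with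
    | zero => exact .inr ⟨0, rfl, hn⟩
    | succ n =>
      rcases h.maps n A hn with hc | ⟨m, hm, hA⟩
      · left
        simpa only [liftSub, hc.rename_closed] using hc
      · exact .inr ⟨m + 1, by simp [liftSub, hm, Tm.rename], hA⟩
  surj m A hm := by
    cases m with
    | zero => exact ⟨0, hm, rfl⟩
    | succ m =>
      obtain ⟨n, hn, hv⟩ := h.surj m A hm
      exact ⟨n + 1, hn, by simp [liftSub, hv, Tm.rename]⟩
  inj n n' m hn hn' hv hv' := by
    -- A closed value is never a variable, so a variable among the lifted values is the shift of a
    -- variable.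
    have key : ∀ n, (Γ.cons X) (n + 1) ≠ none → liftSub σ (n + 1) = .var m →
        ∃ m', m = m' + 1 ∧ σ n = .var m' := by
      intro n hn hv
      obtain ⟨A, hA⟩ := Option.ne_none_iff_exists'.1 hn
      rcases h.maps n A hA with hc | ⟨m', hm', _⟩
      · rw [liftSub, hc.rename_closed] at hv
        exact absurd (hv ▸ hc) not_hasType_empty_var
      · refine ⟨m', ?_, hm'⟩
        simp only [liftSub, hm', Tm.rename, Tm.var.injEq] at hv
        exact hv.symm
    rcases n with _ | n <;> rcases n' with _ | n'
    · rfl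
    · obtain ⟨m', rfl, _⟩ := key n' hn' hv'
      simp [liftSub] at hv
    · obtain ⟨m', rfl, _⟩ := key n hn hv
      simp [liftSub] at hv'
    · obtain ⟨m', rfl, h1⟩ := key n hn hv
      obtain ⟨m'', he, h2⟩ := key n' hn' hv'
      cases he
      exact congrArg _ (h.inj n n' m' hn hn' h1 h2)

open Classical in
-- Each part of `Δ` consists of the images of the variables of the corresponding part of `Γ`.
-- Surjectivity puts every variable of `Δ` into some part, and injectivity keeps it out of the
-- other.
theorem exists_split (h : SubstTy r σ Γ Δ) {Γ₁ Γ₂ : TyCtx} (hΓ : Γ.Split Γ₁ Γ₂) :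
    ∃ Δ₁ Δ₂, Δ.Split Δ₁ Δ₂ ∧ SubstTy r σ Γ₁ Δ₁ ∧ SubstTy r σ Γ₂ Δ₂ := by
  have key : ∀ Γ' : TyCtx, (∀ n A, Γ' n = some A → Γ n = some A) →
      SubstTy r σ Γ' (fun m => if ∃ n, Γ' n ≠ none ∧ σ n = .var m then Δ m else none) := by
    intro Γ' hsub
    have hne : ∀ n, Γ' n ≠ none → Γ n ≠ none := fun n hn => by
      obtain ⟨A, hA⟩ := Option.ne_none_iff_exists'.1 hn
      simp [hsub n A hA]
    refine ⟨fun n A hn => ?_, fun m A hm => ?_, fun n n' m hn hn' => h.inj n n' m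
      (hne n hn) (hne n' hn')⟩
    · refine (h.maps n A (hsub n A hn)).imp_right ?_
      rintro ⟨m, hm, hA⟩
      exact ⟨m, hm, by rw [if_pos ⟨n, by simp [hn], hm⟩, hA]⟩
    · split_ifs at hm with hex
      obtain ⟨n, hn, hv⟩ := hex
      refine ⟨n, ?_, hv⟩
      obtain ⟨n', hn', hv'⟩ := h.surj m A hm
      obtain rfl := h.inj n n' m (hne n hn) (by simp [hn']) hv hv'
      obtain ⟨A', hA'⟩ := Option.ne_none_iff_exists'.1 hn
      rw [hA', ← hsub n A' hA', hn']
  refine ⟨_, _, fun m => ?_, key Γ₁ fun n A => hΓ.left_eq, key Γ₂ fun n A => hΓ.right_eq⟩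
  rcases hm : Δ m with _ | A
  · simp
  · obtain ⟨n, hn, hv⟩ := h.surj m A hm
    have aux : ∀ Γ' : TyCtx, (∀ n A, Γ' n = some A → Γ n = some A) → Γ' n = none →
        ¬ ∃ n', Γ' n' ≠ none ∧ σ n' = .var m := by
      rintro Γ' hsub h0 ⟨n', hn', hv'⟩
      obtain ⟨A', hA'⟩ := Option.ne_none_iff_exists'.1 hn'
      obtain rfl := h.inj n n' m (by simp [hn]) (by simp [hsub n' A' hA']) hv hv'
      exact hn' h0
    rcases hΓ.mem_or hn with ⟨h1, h2⟩ | ⟨h1, h2⟩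
    · right
      exact ⟨if_neg (aux Γ₂ (fun n A => hΓ.right_eq) h2), if_pos ⟨n, by simp [h1], hv⟩⟩
    · left
      exact ⟨if_neg (aux Γ₁ (fun n A => hΓ.left_eq) h2), if_pos ⟨n, by simp [h1], hv⟩⟩

theorem exists_splits (h : SubstTy r σ Γ Δ) {Γ₁ Γ₂ : TyCtx} (hΓ : r.Splits Γ Γ₁ Γ₂) :
    ∃ Δ₁ Δ₂, r.Splits Δ Δ₁ Δ₂ ∧ SubstTy r σ Γ₁ Δ₁ ∧ SubstTy r σ Γ₂ Δ₂ := by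
  cases r with
  | additive =>
    obtain ⟨rfl, rfl⟩ := hΓ
    exact ⟨Δ, Δ, ⟨rfl, rfl⟩, h, h⟩
  | multiplicative => exact h.exists_split hΓ

theorem eq_empty (h : SubstTy r σ Γ Δ) (hσ : ∀ n A, Γ n = some A → HasType r TyCtx.empty (σ n) A) :
    Δ = TyCtx.empty := by
  funext m
  rcases hm : Δ m with _ | A
  · rfl
  · obtain ⟨n, hn, hv⟩ := h.surj m A hm
    exact absurd (hv ▸ hσ n A hn) not_hasType_empty_var

theorem single_cases {n : ℕ} {A : Ty} (h : SubstTy r σ (TyCtx.single n A) Δ) :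
    (HasType r TyCtx.empty (σ n) A ∧ Δ = TyCtx.empty) ∨
      ∃ m, σ n = .var m ∧ Δ = TyCtx.single m A := by
  have hsingle : ∀ k B, TyCtx.single n A k = some B → k = n ∧ B = A := by
    intro k B hk
    unfold TyCtx.single at hk
    split_ifs at hk with hkn
    exact ⟨hkn, (Option.some.inj hk).symm⟩
  rcases h.maps n A (by simp [TyCtx.single]) with hc | ⟨m, hm, hA⟩
  · refine .inl ⟨hc, h.eq_empty fun k B hk => ?_⟩
    obtain ⟨rfl, rfl⟩ := hsingle k B hk
    exact hc
  · refine .inr ⟨m, hm, ?_⟩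
    funext k
    rcases hk : Δ k with _ | B
    · have : k ≠ m := by
        rintro rfl
        simp [hA] at hk
      simp [TyCtx.single, this]
    · obtain ⟨n', hn', hv⟩ := h.surj k B hk
      obtain ⟨rfl, rfl⟩ := hsingle n' B hn'
      rw [hm] at hv
      cases hv
      simp [TyCtx.single]

/-- Serves the rule for `omega`. The variables of `Δ` all lie in the image under `σ` of a finite
set. -/
theorem dom_finite (h : SubstTy r σ Γ Δ) (hΓ : Γ.dom.Finite) : Δ.dom.Finite := by
  refine ((hΓ.image σ).preimage (f := Tm.var) fun _ _ _ _ he => Tm.var.inj he).subset ?_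
  intro m hm
  obtain ⟨A, hA⟩ := Option.ne_none_iff_exists'.1 hm
  obtain ⟨n, hn, hv⟩ := h.surj m A hA
  exact ⟨n, by simp [TyCtx.dom, hn], hv⟩

theorem of_closes (h : Closes r Γ σ) : SubstTy r σ Γ TyCtx.empty where
  maps n A hn := .inl (h n A hn)
  surj m A hm := by cases hm
  inj n n' m hn _ hv _ := by
    obtain ⟨A, hA⟩ := Option.ne_none_iff_exists'.1 hn
    exact absurd (hv ▸ h n A hA) not_hasType_empty_var

theorem of_renames {ρ : ℕ → ℕ} (h : TyCtx.Renames ρ Γ Δ) :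
    SubstTy r (fun n => .var (ρ n)) Γ Δ where
  maps n A hn := .inr ⟨ρ n, rfl, h.1 n A hn⟩
  surj m A hm := by
    obtain ⟨n, hn, rfl⟩ := h.2.1 m A hm
    exact ⟨n, hn, rfl⟩
  inj n n' m hn hn' hv hv' := h.2.2 hn hn' ((Tm.var.inj hv).trans (Tm.var.inj hv').symm)

theorem closes_comp (h : SubstTy r σ Γ Δ) {τ : ℕ → Val} (hτ : Closes r Δ τ) :
    Closes r Γ fun n => (σ n).subst τ := by
  intro n A hn
  rcases h.maps n A hn with hc | ⟨m, hm, hA⟩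
  · simpa only [hc.subst_closed] using hc
  · simp only [hm]
    exact hτ m A hA

end SubstTy

theorem closes_consSub {r : ChoiceRule} {Γ : TyCtx} {X : Ty} {σ : ℕ → Val} {v : Val}
    (hσ : Closes r Γ σ) (hv : HasType r TyCtx.empty v X) : Closes r (Γ.cons X) (consSub v σ) := by
  intro n A hn
  cases n with
  | zero =>
    cases hn
    exact hv
  | succ n => exact hσ n A hn

theorem closes_empty (r : ChoiceRule) (σ : ℕ → Val) : Closes r TyCtx.empty σ :=
  fun _ _ hn => by cases hn

theorem HasType.subst {r : ChoiceRule} {k : Kind} {Γ : TyCtx} {t : Tm k} {A : Ty}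
    (ht : HasType r Γ t A) :
    ∀ {σ : ℕ → Val} {Δ : TyCtx}, SubstTy r σ Γ Δ → HasType r Δ (t.subst σ) A := by
  induction ht with
  | var hΓ =>
    intro σ Δ h
    subst hΓ
    rcases h.single_cases with ⟨hc, rfl⟩ | ⟨m, hm, rfl⟩
    · exact hc
    · simp only [Tm.subst, hm]
      exact .var rfl
  | bool hΓ =>
    intro σ Δ h
    subst hΓ
    exact .bool (h.eq_empty fun n A hn => by cases hn)
  | lam _ ih => exact fun h => .lam (ih (h.lift _))
  | pair hΓ _ _ ih₁ ih₂ =>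
    intro σ Δ h
    obtain ⟨Δ₁, Δ₂, hΔ, h₁, h₂⟩ := h.exists_split hΓ
    exact .pair hΔ (ih₁ h₁) (ih₂ h₂)
  | ret _ ih => exact fun h => .ret (ih h)
  | app hΓ _ _ ih₁ ih₂ =>
    intro σ Δ h
    obtain ⟨Δ₁, Δ₂, hΔ, h₁, h₂⟩ := h.exists_split hΓ
    exact .app hΔ (ih₁ h₁) (ih₂ h₂)
  | ite hΓ _ _ _ ih₁ ih₂ ih₃ =>
    intro σ Δ h
    obtain ⟨Δ₁, Δ₂, hΔ, h₁, h₂⟩ := h.exists_split hΓ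
    exact .ite hΔ (ih₁ h₁) (ih₂ h₂) (ih₃ h₂)
  | letp hΓ _ _ ih₁ ih₂ =>
    intro σ Δ h
    obtain ⟨Δ₁, Δ₂, hΔ, h₁, h₂⟩ := h.exists_split hΓ
    exact .letp hΔ (ih₁ ((h₁.lift _).lift _)) (ih₂ h₂)
  | omega hΓ => exact fun h => .omega (h.dom_finite hΓ)
  | choice hΓ _ _ ih₁ ih₂ =>
    intro σ Δ h
    obtain ⟨Δ₁, Δ₂, hΔ, h₁, h₂⟩ := h.exists_splits hΓ
    exact .choice hΔ (ih₁ h₁) (ih₂ h₂)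

theorem HasType.subst1 {r : ChoiceRule} {e : Trm} {v : Val} {X A : Ty}
    (he : HasType r (TyCtx.empty.cons X) e A) (hv : HasType r TyCtx.empty v X) :
    HasType r TyCtx.empty (e.subst1 v) A :=
  he.subst (.of_closes (closes_consSub (closes_empty r _) hv))

theorem HasType.subst2 {r : ChoiceRule} {e : Trm} {v w : Val} {X Y A : Ty}
    (he : HasType r ((TyCtx.empty.cons X).cons Y) e A) (hv : HasType r TyCtx.empty v X)
    (hw : HasType r TyCtx.empty w Y) : HasType r TyCtx.empty (e.subst2 v w) A :=
  he.subst (.of_closes (closes_consSub (closes_consSub (closes_empty r _) hv) hw))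

/-! ### Evaluation is deterministic, preserves types and terminates -/

theorem appDist_congr {E F : Dist} {G G' : Trm → Val → Dist}
    (h : ∀ s w, Tm.lam s ∈ E.support → w ∈ F.support → G s w = G' s w) :
    appDist E F G = appDist E F G' := by
  refine Finsupp.sum_congr fun u hu => ?_
  cases u with
  | lam s => exact Finsupp.sum_congr fun w hw => by rw [h s w hu hw]
  | var n => rfl
  | bool b => rfl
  | pair v w => rfl

theorem letDist_congr {E : Dist} {G G' : Val → Val → Dist}
    (h : ∀ v w, Tm.pair v w ∈ E.support → G v w = G' v w) : letDist E G = letDist E G' := by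
  refine Finsupp.sum_congr fun u hu => ?_
  cases u with
  | pair v w => simp only [h v w hu]
  | var n => rfl
  | bool b => rfl
  | lam e => rfl

theorem BigStep.unique {e : Trm} {E E' : Dist} (h : BigStep e E) (h' : BigStep e E') :
    E = E' := by
  induction h generalizing E' with
  | ret v => cases h'; rfl
  | omega => cases h'; rfl
  | app _ _ _ ihe ihf ihG =>
    cases h' with
    | app he' hf' hG' =>
      obtain rfl := ihe he'
      obtain rfl := ihf hf'
      exact appDist_congr fun s w hs hw => ihG s w hs hw (hG' s w hs hw)
  | ite _ _ _ ihe ihf ihg =>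
    cases h' with
    | ite he' hf' hg' => rw [ihe he', ihf hf', ihg hg']
  | letp _ _ ihe ihG =>
    cases h' with
    | letp he' hG' =>
      obtain rfl := ihe he'
      exact letDist_congr fun v w hvw => ihG v w hvw (hG' v w hvw)
  | choice _ _ ihe ihf =>
    cases h' with
    | choice he' hf' => rw [ihe he', ihf hf']

theorem BigStep.sem_eq {e : Trm} {E : Dist} (h : BigStep e E) : sem e = E := by
  have hex : ∃ E, BigStep e E := ⟨E, h⟩
  unfold sem
  rw [dif_pos hex]
  exact hex.choose_spec.unique h

theorem mem_support_single_one {u v : Val} :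
    u ∈ (Finsupp.single v (1 : ℝ≥0)).support ↔ u = v := by
  classical
  simp [eq_comm]

theorem exists_mem_support_of_mem_sum {ι : Type} {s : Finset ι} {g : ι → Dist} {u : Val}
    (h : u ∈ (∑ i ∈ s, g i).support) : ∃ i ∈ s, u ∈ (g i).support := by
  classical
  simpa using Finsupp.support_finsetSum h

theorem mem_support_appDist {E F : Dist} {G : Trm → Val → Dist} {u : Val}
    (h : u ∈ (appDist E F G).support) :
    ∃ s w, Tm.lam s ∈ E.support ∧ w ∈ F.support ∧ u ∈ (G s w).support := by
  obtain ⟨v, hv, hu⟩ := exists_mem_support_of_mem_sum h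
  cases v with
  | lam s =>
    obtain ⟨w, hw, hu⟩ := exists_mem_support_of_mem_sum hu
    exact ⟨s, w, hv, hw, Finsupp.support_smul hu⟩
  | var n => simp at hu
  | bool b => simp at hu
  | pair v w => simp at hu

theorem mem_support_letDist {E : Dist} {G : Val → Val → Dist} {u : Val}
    (h : u ∈ (letDist E G).support) :
    ∃ v w, Tm.pair v w ∈ E.support ∧ u ∈ (G v w).support := by
  obtain ⟨v, hv, hu⟩ := exists_mem_support_of_mem_sum h
  cases v with
  | pair v w => exact ⟨v, w, hv, Finsupp.support_smul hu⟩
  | var n => simp at hu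
  | bool b => simp at hu
  | lam e => simp at hu

theorem mem_support_smul_add_smul {E F : Dist} {p q : ℝ≥0} {u : Val}
    (h : u ∈ (p • E + q • F).support) : u ∈ E.support ∨ u ∈ F.support := by
  classical
  exact (Finset.mem_union.1 (Finsupp.support_add h)).imp (fun h => Finsupp.support_smul h)
    fun h => Finsupp.support_smul h

theorem HasType.lam_inv {r : ChoiceRule} {Γ : TyCtx} {s : Trm} {A B : Ty}
    (h : HasType r Γ (Tm.lam s) (.lolli A B)) : HasType r (Γ.cons A) s B := by
  cases h
  assumption

theorem HasType.pair_inv {r : ChoiceRule} {v w : Val} {A B : Ty}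
    (h : HasType r TyCtx.empty (Tm.pair v w) (.tensor A B)) :
    HasType r TyCtx.empty v A ∧ HasType r TyCtx.empty w B := by
  cases h with
  | pair hΓ hv hw =>
    rw [hΓ.left_of_empty] at hv
    rw [hΓ.right_of_empty] at hw
    exact ⟨hv, hw⟩

theorem BigStep.preservation {r : ChoiceRule} {e : Trm} {E : Dist} (h : BigStep e E) {A : Ty}
    (he : HasType r TyCtx.empty e A) : ∀ v ∈ E.support, HasType r TyCtx.empty v A := by
  induction h generalizing A with
  | ret v =>
    cases he with
    | ret hv =>
      intro u hu
      rw [mem_support_single_one] at hu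
      exact hu ▸ hv
  | omega => simp
  | app _ _ _ ihe ihf ihG =>
    cases he with
    | app hΓ he hf =>
      rw [hΓ.left_of_empty] at he
      rw [hΓ.right_of_empty] at hf
      intro u hu
      obtain ⟨s, w, hs, hw, hu⟩ := mem_support_appDist hu
      exact ihG s w hs hw ((ihe he _ hs).lam_inv.subst1 (ihf hf _ hw)) u hu
  | ite _ _ _ _ ihf ihg =>
    cases he with
    | ite hΓ he hf hg =>
      rw [hΓ.right_of_empty] at hf hg
      intro u hu
      exact (mem_support_smul_add_smul hu).elim (ihf hf u) (ihg hg u)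
  | letp _ _ ihe ihG =>
    cases he with
    | letp hΓ hf he =>
      rw [hΓ.left_of_empty] at hf
      rw [hΓ.right_of_empty] at he
      intro u hu
      obtain ⟨v, w, hvw, hu⟩ := mem_support_letDist hu
      have := (ihe he _ hvw).pair_inv
      exact ihG v w hvw (hf.subst2 this.1 this.2) u hu
  | choice _ _ ihe ihf =>
    cases he with
    | choice hΓ he hf =>
      rw [hΓ.of_empty.1] at he
      rw [hΓ.of_empty.2] at hf
      intro u hu
      exact (mem_support_smul_add_smul hu).elim (ihe he u) (ihf hf u)

/-- Reducible values: a function is reducible if it maps reducible arguments to terms that evaluate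
to distributions of reducible values. -/
def Reducible : Ty → Val → Prop
  | .bool, v => ∃ b, v = .bool b
  | .lolli A B, v => ∃ s : Trm, v = .lam s ∧
      ∀ w, Reducible A w → ∃ E, BigStep (s.subst1 w) E ∧ ∀ u ∈ E.support, Reducible B u
  | .tensor A B, v => ∃ v₁ v₂, v = .pair v₁ v₂ ∧ Reducible A v₁ ∧ Reducible B v₂

/-- Terms that evaluate to distributions of reducible values, and reducible values. -/
def ReducibleTm (A : Ty) : {k : Kind} → Tm k → Prop
  | .term, e => ∃ E, BigStep e E ∧ ∀ u ∈ E.support, Reducible A u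
  | .value, v => Reducible A v

/-- `σ` replaces every variable of `Γ` by a reducible value of its type. -/
def ReducibleSub (Γ : TyCtx) (σ : ℕ → Val) : Prop := ∀ n A, Γ n = some A → Reducible A (σ n)

theorem ReducibleSub.cons {Γ : TyCtx} {σ : ℕ → Val} {A : Ty} {v : Val} (h : ReducibleSub Γ σ)
    (hv : Reducible A v) : ReducibleSub (Γ.cons A) (consSub v σ) := by
  intro n B hn
  cases n with
  | zero =>
    cases hn
    exact hv
  | succ n => exact h n B hn

/-- The fundamental lemma of the logical relation. Only the inclusion of the parts of a split in the
whole context matters, not their disjointness. -/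
theorem HasType.reducible {r : ChoiceRule} {k : Kind} {Γ : TyCtx} {t : Tm k} {A : Ty}
    (ht : HasType r Γ t A) : ∀ {σ : ℕ → Val}, ReducibleSub Γ σ → ReducibleTm A (t.subst σ) := by
  induction ht with
  | @var Γ n A hΓ => exact fun h => h n A (by simp [hΓ, TyCtx.single])
  | @bool Γ b _ => exact fun _ => ⟨b, rfl⟩
  | lam _ ih =>
    intro σ h
    refine ⟨_, rfl, fun w hw => ?_⟩
    rw [Tm.subst1_liftSub]
    exact ih (h.cons hw)
  | pair hΓ _ _ ih₁ ih₂ =>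
    exact fun h => ⟨_, _, rfl, ih₁ fun n A hn => h n A (hΓ.left_eq hn),
      ih₂ fun n A hn => h n A (hΓ.right_eq hn)⟩
  | ret _ ih =>
    refine fun h => ⟨_, .ret _, fun u hu => ?_⟩
    rw [mem_support_single_one] at hu
    exact hu ▸ ih h
  | @app Γ Γ₁ Γ₂ e f A B hΓ _ _ ih₁ ih₂ =>
    intro σ h
    obtain ⟨E, hE, rE⟩ := ih₁ fun n A hn => h n A (hΓ.left_eq hn)
    obtain ⟨F, hF, rF⟩ := ih₂ fun n A hn => h n A (hΓ.right_eq hn)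
    -- The evaluation rule asks for a family of distributions indexed by all `s` and `w`, while
    -- reducibility provides them on the supports only; `sem` is a total choice.
    have key : ∀ s w, Tm.lam s ∈ E.support → w ∈ F.support →
        BigStep (s.subst1 w) (sem (s.subst1 w)) ∧
          ∀ u ∈ (sem (s.subst1 w)).support, Reducible B u := by
      intro s w hs hw
      obtain ⟨s', he, hs'⟩ := rE _ hs
      cases he
      obtain ⟨D, hD, rD⟩ := hs' w (rF w hw)
      rw [hD.sem_eq]
      exact ⟨hD, rD⟩
    refine ⟨_, .app hE hF fun s w hs hw => (key s w hs hw).1, fun u hu => ?_⟩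
    obtain ⟨s, w, hs, hw, hu⟩ := mem_support_appDist hu
    exact (key s w hs hw).2 u hu
  | ite hΓ _ _ _ ih₁ ih₂ ih₃ =>
    intro σ h
    obtain ⟨E, hE, rE⟩ := ih₁ fun n A hn => h n A (hΓ.left_eq hn)
    obtain ⟨F, hF, rF⟩ := ih₂ fun n A hn => h n A (hΓ.right_eq hn)
    obtain ⟨G, hG, rG⟩ := ih₃ fun n A hn => h n A (hΓ.right_eq hn)
    exact ⟨_, .ite hE hF hG, fun u hu => (mem_support_smul_add_smul hu).elim (rF u) (rG u)⟩
  | @letp Γ Γ₁ Γ₂ e f A X Y hΓ _ _ ih₁ ih₂ =>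
    intro σ h
    have h₁ : ReducibleSub Γ₁ σ := fun n A hn => h n A (hΓ.left_eq hn)
    obtain ⟨E, hE, rE⟩ := ih₂ fun n A hn => h n A (hΓ.right_eq hn)
    have key : ∀ v w, Tm.pair v w ∈ E.support →
        BigStep ((f.subst (liftSub (liftSub σ))).subst2 v w)
          (sem ((f.subst (liftSub (liftSub σ))).subst2 v w)) ∧
          ∀ u ∈ (sem ((f.subst (liftSub (liftSub σ))).subst2 v w)).support, Reducible A u := by
      intro v w hvw
      obtain ⟨v', w', he, hv, hw⟩ := rE _ hvw
      cases he
      rw [Tm.subst2_liftSub]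
      obtain ⟨D, hD, rD⟩ := ih₁ ((h₁.cons hv).cons hw)
      rw [hD.sem_eq]
      exact ⟨hD, rD⟩
    refine ⟨_, .letp hE fun v w hvw => (key v w hvw).1, fun u hu => ?_⟩
    obtain ⟨v, w, hvw, hu⟩ := mem_support_letDist hu
    exact (key v w hvw).2 u hu
  | omega _ => exact fun _ => ⟨0, .omega, by simp⟩
  | choice hΓ _ _ ih₁ ih₂ =>
    intro σ h
    obtain ⟨E, hE, rE⟩ := ih₁ fun n A hn => h n A (hΓ.left_eq hn)
    obtain ⟨F, hF, rF⟩ := ih₂ fun n A hn => h n A (hΓ.right_eq hn)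
    exact ⟨_, .choice hE hF, fun u hu => (mem_support_smul_add_smul hu).elim (rE u) (rF u)⟩

/-- Ensures that `sem` is not the default value `0` of a term without evaluation. -/
theorem HasType.bigStep_sem {r : ChoiceRule} {e : Trm} {A : Ty}
    (he : HasType r TyCtx.empty e A) : BigStep e (sem e) := by
  obtain ⟨E, hE, _⟩ := he.reducible (σ := Tm.var) fun n A hn => by cases hn
  rw [Tm.subst_var] at hE
  rwa [hE.sem_eq]

/-! ### Expectations -/

/-- The expectation of `φ` under `E`. -/
noncomputable def Dist.expect (E : Dist) (φ : Val → ℝ≥0) : ℝ≥0 := E.sum fun v p => p * φ v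

namespace Dist

theorem expect_zero (φ : Val → ℝ≥0) : expect 0 φ = 0 := rfl

theorem expect_add (E F : Dist) (φ : Val → ℝ≥0) :
    (E + F).expect φ = E.expect φ + F.expect φ :=
  Finsupp.sum_add_index' (fun _ => zero_mul _) fun _ _ _ => add_mul _ _ _

theorem expect_smul (c : ℝ≥0) (E : Dist) (φ : Val → ℝ≥0) :
    (c • E).expect φ = c * E.expect φ := by
  unfold expect
  rw [Finsupp.sum_smul_index fun _ => zero_mul _, Finsupp.sum, Finsupp.sum, Finset.mul_sum]
  exact Finset.sum_congr rfl fun _ _ => mul_assoc _ _ _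

theorem expect_finset_sum {ι : Type} (s : Finset ι) (g : ι → Dist) (φ : Val → ℝ≥0) :
    (∑ i ∈ s, g i).expect φ = ∑ i ∈ s, (g i).expect φ := by
  classical
  induction s using Finset.induction_on with
  | empty => rfl
  | insert a s ha ih => rw [Finset.sum_insert ha, Finset.sum_insert ha, expect_add, ih]

theorem expect_single (v : Val) (φ : Val → ℝ≥0) :
    expect (Finsupp.single v 1) φ = φ v := by
  simp [expect]

theorem expect_one (E : Dist) : (E.expect fun _ => 1) = E.mass := by
  simp [expect, mass]

theorem expect_mono {E : Dist} {φ ψ : Val → ℝ≥0} (h : ∀ u ∈ E.support, φ u ≤ ψ u) :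
    E.expect φ ≤ E.expect ψ :=
  Finset.sum_le_sum fun u hu => mul_le_mul_right (h u hu) _

/-- Written as an iterated expectation, the integrand becomes a test function to which a lifting for
`E` or for `F` applies. -/
theorem expect_appDist (E F : Dist) (G : Trm → Val → Dist) (φ : Val → ℝ≥0) :
    (appDist E F G).expect φ = E.expect fun u =>
      match u with
      | .lam s => F.expect fun w => (G s w).expect φ
      | _ => 0 := by
  unfold appDist
  rw [Finsupp.sum, expect_finset_sum]
  refine Finset.sum_congr rfl fun u _ => ?_
  cases u with
  | lam s =>
    show expect (∑ w ∈ F.support, (E (Tm.lam s) * F w) • G s w) φ =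
      E (Tm.lam s) * ∑ w ∈ F.support, F w * (G s w).expect φ
    rw [expect_finset_sum, Finset.mul_sum]
    exact Finset.sum_congr rfl fun w _ => by rw [expect_smul, mul_assoc]
  | var n => simp [expect_zero]
  | bool b => simp [expect_zero]
  | pair v w => simp [expect_zero]

theorem expect_letDist (E : Dist) (G : Val → Val → Dist) (φ : Val → ℝ≥0) :
    (letDist E G).expect φ = E.expect fun u =>
      match u with
      | .pair v w => (G v w).expect φ
      | _ => 0 := by
  unfold letDist
  rw [Finsupp.sum, expect_finset_sum]
  refine Finset.sum_congr rfl fun u _ => ?_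
  cases u with
  | pair v w => exact expect_smul _ _ _
  | var n => simp [expect_zero]
  | bool b => simp [expect_zero]
  | lam e => simp [expect_zero]

end Dist

/-! ### The lifting of a relation from values to distributions -/

/-- `E` is below `F` in the lifting of `R`: expectations under `E` are bounded by those under `F` of
any function that dominates along `R`. -/
def Dist.Lift (R : Val → Val → Prop) (E F : Dist) : Prop :=
  ∀ φ ψ : Val → ℝ≥0, (∀ u v, R u v → φ u ≤ ψ v) → E.expect φ ≤ F.expect ψ

theorem Dist.expect_congr {E : Dist} {φ ψ : Val → ℝ≥0} (h : ∀ u ∈ E.support, φ u = ψ u) :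
    E.expect φ = E.expect ψ :=
  Finsupp.sum_congr fun u hu => by rw [h u hu]

open Classical in
/-- Only the values in the supports matter in the definition of the lifting. -/
theorem Dist.Lift.expect_le {R : Val → Val → Prop} {E F : Dist} (h : E.Lift R F)
    {φ ψ : Val → ℝ≥0} (hφ : ∀ u ∈ E.support, ∀ v ∈ F.support, R u v → φ u ≤ ψ v) :
    E.expect φ ≤ F.expect ψ := by
  -- Off the supports, `φ` is replaced by the least value `0` and `ψ` by the sum of `φ` over the
  -- support of `E`, which bounds `φ` there. Domination along `R` is then automatic unless both
  -- values lie in the supports.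
  have hE : E.expect φ = E.expect fun u => if u ∈ E.support then φ u else 0 :=
    expect_congr fun u hu => (if_pos hu).symm
  have hF : F.expect ψ =
      F.expect fun v => if v ∈ F.support then ψ v else ∑ u ∈ E.support, φ u :=
    expect_congr fun v hv => (if_pos hv).symm
  rw [hE, hF]
  refine h _ _ fun u v huv => ?_
  split_ifs with hu hv
  · exact hφ u hu v hv huv
  · exact Finset.single_le_sum (f := φ) (fun _ _ => zero_le) hu
  · exact zero_le
  · exact zero_le

theorem Dist.Lift.refl {R : Val → Val → Prop} {E : Dist} (h : ∀ u ∈ E.support, R u u) :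
    E.Lift R E :=
  fun _ _ hφ => expect_mono fun u hu => hφ u u (h u hu)

theorem Dist.Lift.mono {R S : Val → Val → Prop} {E F : Dist} (h : E.Lift R F)
    (hRS : ∀ u v, R u v → S u v) : E.Lift S F :=
  fun φ ψ hφ => h φ ψ fun u v huv => hφ u v (hRS u v huv)

theorem Dist.Lift.single {R : Val → Val → Prop} {u v : Val} (h : R u v) :
    Dist.Lift R (Finsupp.single u 1) (Finsupp.single v 1) := by
  intro φ ψ hφ
  rw [expect_single, expect_single]
  exact hφ u v h

/-- The layer-cake formula: `φ u` is the length of `[0, φ u)`, and the finite sum is exchanged with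
the integral. -/
theorem Dist.expect_eq_lintegral (E : Dist) (φ : Val → ℝ≥0) :
    (E.expect φ : ℝ≥0∞) = ∫⁻ x : ℝ, ∑ u ∈ E.support,
      (E u : ℝ≥0∞) * (Set.Ico 0 (φ u : ℝ)).indicator 1 x := by
  rw [MeasureTheory.lintegral_finsetSum _ fun u _ =>
    (measurable_one.indicator measurableSet_Ico).const_mul _]
  unfold Dist.expect Finsupp.sum
  push_cast
  refine Finset.sum_congr rfl fun u _ => ?_
  rw [MeasureTheory.lintegral_const_mul _ (measurable_one.indicator measurableSet_Ico),
    MeasureTheory.lintegral_indicator_one measurableSet_Ico, Real.volume_Ico]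
  simp

open Classical in
theorem Dist.sum_indicator_eq (E : Dist) (φ : Val → ℝ≥0) (x : ℝ) :
    ∑ u ∈ E.support, (E u : ℝ≥0∞) * (Set.Ico 0 (φ u : ℝ)).indicator 1 x =
      ∑ u ∈ E.support with x ∈ Set.Ico 0 (φ u : ℝ), (E u : ℝ≥0∞) := by
  rw [Finset.sum_filter]
  refine Finset.sum_congr rfl fun u _ => ?_
  by_cases hx : x ∈ Set.Ico 0 (φ u : ℝ)
  · rw [Set.indicator_of_mem hx, if_pos hx, Pi.one_apply, mul_one]
  · rw [Set.indicator_of_notMem hx, if_neg hx, mul_zero]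

open Classical in
/-- The lifting is determined by the inequalities `E(X) ≤ F(R(X))`, by integration over the
superlevel sets of the test functions. -/
theorem Dist.Lift.of_sets {R : Val → Val → Prop} {E F : Dist}
    (h : ∀ X ⊆ E.support, ∑ u ∈ X, (E u : ℝ≥0∞) ≤
      ∑ v ∈ F.support with ∃ u ∈ X, R u v, (F v : ℝ≥0∞)) : E.Lift R F := by
  intro φ ψ hφ
  rw [← ENNReal.coe_le_coe, expect_eq_lintegral, expect_eq_lintegral]
  refine MeasureTheory.lintegral_mono fun x => ?_
  simp only [sum_indicator_eq]
  -- For `x ≥ 0`, the `R`-image of the superlevel set `φ > x` lies in the superlevel set `ψ > x`;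
  -- for negative `x` both sets of values are empty.
  refine (h _ (Finset.filter_subset _ _)).trans (Finset.sum_le_sum_of_subset fun v hv => ?_)
  simp only [Finset.mem_filter, Set.mem_Ico] at hv ⊢
  obtain ⟨hv, u, ⟨hu, h0, hx⟩, hR⟩ := hv
  exact ⟨hv, h0, hx.trans_le (by exact_mod_cast hφ u v hR)⟩

/-! ### Similarity of states -/

namespace LMC

variable {S L : Type}

theorem Similar.probSet_le {M : LMC S L} {s t : S} (h : M.Similar s t) (l : L) (X : Set S) :
    M.probSet s l X ≤ M.probSet t l {u | ∃ x ∈ X, M.Similar x u} := by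
  obtain ⟨R, hR, hst⟩ := h
  refine (hR.2.2 s t hst l X).trans ?_
  exact ENNReal.tsum_mono_subtype _ fun u ⟨x, hx, hxu⟩ => ⟨x, hx, R, hR, hxu⟩

theorem probSet_eq_tsum_indicator (M : LMC S L) (s : S) (l : L) (X : Set S) :
    M.probSet s l X = ∑' t, X.indicator (M.prob s l) t :=
  tsum_subtype X (M.prob s l)

/-- The saturation of `X` contains `X` and is a union of classes, and each class has the same
probability from `s` as from `t`. -/
theorem probSet_le_of_forall_class {M : LMC S L} (c : Setoid S) {s t : S} {l : L}
    (h : ∀ x, M.probSet s l {u | c x u} = M.probSet t l {u | c x u}) (X : Set S) :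
    M.probSet s l X ≤ M.probSet t l {u | ∃ x ∈ X, c x u} := by
  let Y : Set S := {u | ∃ x ∈ X, c x u}
  have hdecomp : ∀ s', M.probSet s' l Y =
      ∑' q : Quotient c, ∑' u : {u // (Quotient.mk c u) = q}, Y.indicator (M.prob s' l) u := by
    intro s'
    rw [probSet_eq_tsum_indicator, ← ENNReal.tsum_sigma,
      ← (Equiv.sigmaFiberEquiv (Quotient.mk c)).tsum_eq]
    rfl
  have hclass : ∀ s' x, (∑' u : {u // (Quotient.mk c u) = Quotient.mk c x},
      M.prob s' l u) = M.probSet s' l {u | c x u} := by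
    intro s' x
    have : {u | Quotient.mk c u = Quotient.mk c x} = {u | c x u} := by
      ext u
      exact ⟨fun h => c.symm (Quotient.exact h), fun h => Quotient.sound (c.symm h)⟩
    unfold probSet
    rw [← this]
    rfl
  calc M.probSet s l X ≤ M.probSet s l Y :=
        ENNReal.tsum_mono_subtype _ fun x hx => ⟨x, hx, c.refl x⟩
    _ = M.probSet t l Y := by
        rw [hdecomp, hdecomp]
        refine tsum_congr fun q => ?_
        induction q using Quotient.inductionOn with
        | h x =>
          -- A class is either contained in the saturated set `Y` or disjoint from it.
          by_cases hx : x ∈ Y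
          · have hY : ∀ u : {u // Quotient.mk c u = Quotient.mk c x}, (u : S) ∈ Y := by
              rintro ⟨u, hu⟩
              obtain ⟨y, hy, hyx⟩ := hx
              exact ⟨y, hy, c.trans hyx (c.symm (Quotient.exact hu))⟩
            simp only [Set.indicator_of_mem (hY _)]
            rw [hclass, hclass, h]
          · have hY : ∀ u : {u // Quotient.mk c u = Quotient.mk c x}, (u : S) ∉ Y := by
              rintro ⟨u, hu⟩ ⟨y, hy, hyu⟩
              exact hx ⟨y, hy, c.trans hyu (Quotient.exact hu)⟩
            simp only [Set.indicator_of_notMem (hY _)]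

theorem Bisimilar.similar {M : LMC S L} {s t : S} (h : M.Bisimilar s t) : M.Similar s t := by
  obtain ⟨R, ⟨hR, hb⟩, hst⟩ := h
  exact ⟨R, ⟨hR.refl, fun _ _ _ => hR.trans, fun s t hst l X =>
    probSet_le_of_forall_class ⟨R, hR⟩ (hb s t hst l) X⟩, hst⟩

theorem Bisimilar.symm {M : LMC S L} {s t : S} (h : M.Bisimilar s t) : M.Bisimilar t s := by
  obtain ⟨R, hR, hst⟩ := h
  exact ⟨R, hR, hR.1.symm hst⟩

end LMC

/-! ### Similarity in the chain of the calculus -/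

section Chain

variable {r : ChoiceRule}

open Classical in
theorem transProb_val (v : Val) (A : Ty) (h : HasType r TyCtx.empty v A) (l : Label r)
    (t : State r) :
    (chain r).prob (.val v A h) l t = if Fires r (.val v A h) l t then 1 else 0 := by
  cases l <;> cases t <;> rfl

/-- Transitions from value states have probability zero or one, so the simulation condition for the
singleton `{t}` forces a matching transition. -/
theorem Similar.fires {v v' : Val} {A A' : Ty} {h : HasType r TyCtx.empty v A}
    {h' : HasType r TyCtx.empty v' A'} (hs : (chain r).Similar (.val v A h) (.val v' A' h'))
    {l : Label r} {t : State r} (ht : Fires r (.val v A h) l t) :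
    ∃ t', Fires r (.val v' A' h') l t' ∧ (chain r).Similar t t' := by
  classical
  have hle := hs.probSet_le l {t}
  by_contra hno
  have h0 : (chain r).probSet (.val v' A' h') l {u | ∃ x ∈ ({t} : Set _), (chain r).Similar x u}
      = 0 := by
    refine ENNReal.tsum_eq_zero.2 ?_
    rintro ⟨u, x, rfl, hxu⟩
    rw [transProb_val, if_neg fun hF => hno ⟨u, hF, hxu⟩]
  have h1 : (chain r).probSet (.val v A h) l {t} = 1 := by
    unfold LMC.probSet
    rw [tsum_singleton t ((chain r).prob (.val v A h) l), transProb_val, if_pos ht]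
  rw [h0, h1] at hle
  exact absurd hle (by simp)

/-- Similarity of closed values of type `A`. -/
def ValSim (r : ChoiceRule) (A : Ty) (v v' : Val) : Prop :=
  ∃ (h : HasType r TyCtx.empty v A) (h' : HasType r TyCtx.empty v' A),
    (chain r).Similar (.val v A h) (.val v' A h')

theorem AppSim.of_similar {e f : Trm} {A : Ty} {he : HasType r TyCtx.empty e A}
    {hf : HasType r TyCtx.empty f A} (h : (chain r).Similar (.tm e A he) (.tm f A hf)) :
    AppSim r TyCtx.empty A e f := by
  intro σ _
  rw [he.subst_closed, hf.subst_closed]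
  exact ⟨he, hf, h⟩

theorem AppSim.similar {e f : Trm} {A : Ty} (h : AppSim r TyCtx.empty A e f) :
    ∃ (he : HasType r TyCtx.empty e A) (hf : HasType r TyCtx.empty f A),
      (chain r).Similar (.tm e A he) (.tm f A hf) := by
  simpa only [Tm.subst_var] using h Tm.var (closes_empty r _)

theorem AppSim.subst {Γ Δ : TyCtx} {e f : Trm} {A : Ty} (h : AppSim r Γ A e f) {σ : ℕ → Val}
    (hσ : SubstTy r σ Γ Δ) : AppSim r Δ A (e.subst σ) (f.subst σ) := by
  intro τ hτ
  rw [Tm.subst_subst, Tm.subst_subst]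
  exact h _ (hσ.closes_comp hτ)

theorem HasType.eq_bool {v : Val} (h : HasType r TyCtx.empty v .bool) : ∃ b, v = .bool b := by
  cases h with
  | var hΓ => exact absurd hΓ (TyCtx.empty_ne_single _ _)
  | bool _ => exact ⟨_, rfl⟩

theorem HasType.eq_lam {v : Val} {A B : Ty} (h : HasType r TyCtx.empty v (.lolli A B)) :
    ∃ s : Trm, v = .lam s := by
  cases h with
  | var hΓ => exact absurd hΓ (TyCtx.empty_ne_single _ _)
  | lam _ => exact ⟨_, rfl⟩

theorem HasType.eq_pair {v : Val} {A B : Ty} (h : HasType r TyCtx.empty v (.tensor A B)) :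
    ∃ v₁ v₂, v = .pair v₁ v₂ := by
  cases h with
  | var hΓ => exact absurd hΓ (TyCtx.empty_ne_single _ _)
  | pair _ _ _ => exact ⟨_, _, rfl⟩

theorem ValSim.eq_of_bool {v v' : Val} (h : ValSim r .bool v v') : v = v' := by
  obtain ⟨hv, hv', hs⟩ := h
  obtain ⟨b, rfl⟩ := hv.eq_bool
  obtain ⟨t, ht, _⟩ := Similar.fires hs (Fires.bool b hv)
  cases ht
  rfl

theorem ValSim.subst1 {s s' : Trm} {A B : Ty} (h : ValSim r (.lolli A B) (.lam s) (.lam s'))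
    {w : Val} (hw : HasType r TyCtx.empty w A) :
    AppSim r TyCtx.empty B (s.subst1 w) (s'.subst1 w) := by
  obtain ⟨hv, hv', hs⟩ := h
  obtain ⟨t, ht, hst⟩ := Similar.fires hs (Fires.lam s w A B hv hw (hv.lam_inv.subst1 hw))
  cases ht
  exact .of_similar hst

/-- The body of a `let` is itself a label, so similar pairs need not be compared component by
component. -/
theorem ValSim.subst2 {v w v' w' : Val} {A B : Ty}
    (h : ValSim r (.tensor A B) (.pair v w) (.pair v' w')) {e : Trm} {C : Ty}
    (he : HasType r ((TyCtx.empty.cons A).cons B) e C) :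
    AppSim r TyCtx.empty C (e.subst2 v w) (e.subst2 v' w') := by
  obtain ⟨hv, hv', hs⟩ := h
  obtain ⟨t, ht, hst⟩ := Similar.fires hs
    (Fires.pair v w e A B C hv he (he.subst2 hv.pair_inv.1 hv.pair_inv.2))
  cases ht
  exact .of_similar hst

open Classical in
theorem probSet_eval {e : Trm} {A : Ty} (he : HasType r TyCtx.empty e A) (X : Set (State r)) :
    (chain r).probSet (.tm e A he) .eval X =
      ∑ v ∈ (sem e).support with ∃ h, State.val v A h ∈ X, (sem e v : ℝ≥0∞) := by
  let g : Val → ℝ≥0∞ := fun v => if ∃ h, State.val v A h ∈ X then (sem e v : ℝ≥0∞) else 0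
  let i : {v : Val // HasType r TyCtx.empty v A} → State r := fun v => .val v A v.2
  have hi : Function.Injective i := fun v w h => Subtype.ext (State.val.inj h).1
  have hsupp : Function.support (X.indicator ((chain r).prob (.tm e A he) .eval)) ⊆ Set.range i := by
    intro t ht
    have ht : transProb r (.tm e A he) .eval t ≠ 0 := (Set.indicator_apply_ne_zero.1 ht).2
    cases t with
    | tm f B hf => exact absurd (if_neg fun hF => by cases hF) ht
    | val v B hv =>
      by_cases hAB : A = B
      · subst hAB
        exact ⟨⟨v, hv⟩, rfl⟩
      · exact absurd (if_neg hAB) ht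
  have hig : ∀ v, X.indicator ((chain r).prob (.tm e A he) .eval) (i v) = g v := by
    intro v
    by_cases hv : i v ∈ X
    · rw [Set.indicator_of_mem hv]
      exact (if_pos rfl).trans (if_pos (⟨v.2, hv⟩ : ∃ h, State.val v.1 A h ∈ X)).symm
    · rw [Set.indicator_of_notMem hv]
      exact (if_neg (fun ⟨_, h⟩ => hv h : ¬ ∃ h, State.val v.1 A h ∈ X)).symm
  have hg : Function.support g ⊆ {v | HasType r TyCtx.empty v A} := by
    intro v hv
    by_contra hno
    exact hv (if_neg fun ⟨h, _⟩ => hno h)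
  rw [LMC.probSet_eq_tsum_indicator, ← hi.tsum_eq hsupp]
  simp only [hig]
  refine (tsum_subtype_eq_of_support_subset hg).trans ?_
  rw [tsum_eq_sum (s := (sem e).support), Finset.sum_filter]
  intro v hv
  simp [g, Finsupp.notMem_support_iff.1 hv]

open Classical in
-- The simulation condition for `eval` is applied to the value states over a set of values in the
-- support; preservation guarantees that these values are typed and thus are states.
theorem AppSim.lift_valSim {e f : Trm} {A : Ty} (h : AppSim r TyCtx.empty A e f) :
    (sem e).Lift (ValSim r A) (sem f) := by
  obtain ⟨he, hf, hs⟩ := h.similar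
  refine .of_sets fun Y hY => ?_
  obtain ⟨X, hX⟩ : ∃ X : Set (State r), ∀ t, t ∈ X ↔ ∃ v ∈ Y, ∃ h, t = .val v A h :=
    ⟨{t | ∃ v ∈ Y, ∃ h, t = .val v A h}, fun _ => Iff.rfl⟩
  obtain ⟨Z, hZ⟩ : ∃ Z, Z = {t | ∃ x ∈ X, (chain r).Similar x t} := ⟨_, rfl⟩
  have hle := hs.probSet_le .eval X
  rw [← hZ, probSet_eval, probSet_eval] at hle
  refine le_trans (Finset.sum_le_sum_of_subset fun v hv => ?_)
    (hle.trans (Finset.sum_le_sum_of_subset fun v hv => ?_))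
  · have hv' := he.bigStep_sem.preservation he v (hY hv)
    exact Finset.mem_filter.2 ⟨hY hv, hv', (hX _).2 ⟨v, hv, hv', rfl⟩⟩
  · obtain ⟨hv, h', hvZ⟩ := Finset.mem_filter.1 hv
    rw [hZ] at hvZ
    obtain ⟨t, ht, hsim⟩ := hvZ
    obtain ⟨u, hu, h, rfl⟩ := (hX t).1 ht
    exact Finset.mem_filter.2 ⟨hv, u, hu, h, h', hsim⟩

end Chain

/-! ### The one-sided compatible closure of similarity -/

/-- The closure of similarity under the term formers. Only one of the components of an application,
a pair or a `let` may change. -/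
inductive Rel (r : ChoiceRule) : {k : Kind} → TyCtx → Tm k → Tm k → Ty → Prop where
  | refl {k : Kind} {Γ : TyCtx} {t : Tm k} {A : Ty} (ht : HasType r Γ t A) : Rel r Γ t t A
  | sim {Γ : TyCtx} {e f : Trm} {A : Ty} (he : HasType r Γ e A) (hf : HasType r Γ f A)
      (h : AppSim r Γ A e f) : Rel r Γ e f A
  | valSim {Γ : TyCtx} {v w : Val} {A : Ty} (hΓ : Γ = TyCtx.empty) (h : ValSim r A v w) :
      Rel r Γ v w A
  | lam {Γ : TyCtx} {e e' : Trm} {A B : Ty} (he : Rel r (Γ.cons A) e e' B) :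
      Rel r Γ (.lam e) (.lam e') (.lolli A B)
  | pairL {Γ Γ₁ Γ₂ : TyCtx} {v v' w : Val} {A B : Ty} (hΓ : Γ.Split Γ₁ Γ₂)
      (hv : Rel r Γ₁ v v' A) (hw : HasType r Γ₂ w B) :
      Rel r Γ (.pair v w) (.pair v' w) (.tensor A B)
  | pairR {Γ Γ₁ Γ₂ : TyCtx} {v w w' : Val} {A B : Ty} (hΓ : Γ.Split Γ₁ Γ₂)
      (hv : HasType r Γ₁ v A) (hw : Rel r Γ₂ w w' B) :
      Rel r Γ (.pair v w) (.pair v w') (.tensor A B)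
  | ret {Γ : TyCtx} {v v' : Val} {A : Ty} (hv : Rel r Γ v v' A) : Rel r Γ (.ret v) (.ret v') A
  | appL {Γ Γ₁ Γ₂ : TyCtx} {e e' f : Trm} {A B : Ty} (hΓ : Γ.Split Γ₁ Γ₂)
      (he : Rel r Γ₁ e e' (.lolli A B)) (hf : HasType r Γ₂ f A) :
      Rel r Γ (.app e f) (.app e' f) B
  | appR {Γ Γ₁ Γ₂ : TyCtx} {e f f' : Trm} {A B : Ty} (hΓ : Γ.Split Γ₁ Γ₂)
      (he : HasType r Γ₁ e (.lolli A B)) (hf : Rel r Γ₂ f f' A) :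
      Rel r Γ (.app e f) (.app e f') B
  | ite {Γ Γ₁ Γ₂ : TyCtx} {e e' f f' g g' : Trm} {A : Ty} (hΓ : Γ.Split Γ₁ Γ₂)
      (he : Rel r Γ₁ e e' .bool) (hf : Rel r Γ₂ f f' A) (hg : Rel r Γ₂ g g' A) :
      Rel r Γ (.ite e f g) (.ite e' f' g') A
  | letL {Γ Γ₁ Γ₂ : TyCtx} {e e' f : Trm} {A X Y : Ty} (hΓ : Γ.Split Γ₁ Γ₂)
      (hf : HasType r ((Γ₁.cons X).cons Y) f A) (he : Rel r Γ₂ e e' (.tensor X Y)) :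
      Rel r Γ (.letp e f) (.letp e' f) A
  | letR {Γ Γ₁ Γ₂ : TyCtx} {e f f' : Trm} {A X Y : Ty} (hΓ : Γ.Split Γ₁ Γ₂)
      (hf : Rel r ((Γ₁.cons X).cons Y) f f' A) (he : HasType r Γ₂ e (.tensor X Y)) :
      Rel r Γ (.letp e f) (.letp e f') A
  | choice {Γ Γ₁ Γ₂ : TyCtx} {e e' f f' : Trm} {A : Ty} (hΓ : r.Splits Γ Γ₁ Γ₂)
      (he : Rel r Γ₁ e e' A) (hf : Rel r Γ₂ f f' A) : Rel r Γ (.choice e f) (.choice e' f') A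

namespace Rel

variable {r : ChoiceRule}

theorem left {k : Kind} {Γ : TyCtx} {t t' : Tm k} {A : Ty} (h : Rel r Γ t t' A) :
    HasType r Γ t A := by
  induction h with
  | refl ht => exact ht
  | sim he _ _ => exact he
  | valSim hΓ h => exact hΓ ▸ h.1
  | lam _ ih => exact .lam ih
  | pairL hΓ _ hw ih => exact .pair hΓ ih hw
  | pairR hΓ hv _ ih => exact .pair hΓ hv ih
  | ret _ ih => exact .ret ih
  | appL hΓ _ hf ih => exact .app hΓ ih hf
  | appR hΓ he _ ih => exact .app hΓ he ih
  | ite hΓ _ _ _ ih₁ ih₂ ih₃ => exact .ite hΓ ih₁ ih₂ ih₃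
  | letL hΓ hf _ ih => exact .letp hΓ hf ih
  | letR hΓ _ he ih => exact .letp hΓ ih he
  | choice hΓ _ _ ih₁ ih₂ => exact .choice hΓ ih₁ ih₂

theorem right {k : Kind} {Γ : TyCtx} {t t' : Tm k} {A : Ty} (h : Rel r Γ t t' A) :
    HasType r Γ t' A := by
  induction h with
  | refl ht => exact ht
  | sim _ hf _ => exact hf
  | valSim hΓ h => exact hΓ ▸ h.2.1
  | lam _ ih => exact .lam ih
  | pairL hΓ _ hw ih => exact .pair hΓ ih hw
  | pairR hΓ hv _ ih => exact .pair hΓ hv ih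
  | ret _ ih => exact .ret ih
  | appL hΓ _ hf ih => exact .app hΓ ih hf
  | appR hΓ he _ ih => exact .app hΓ he ih
  | ite hΓ _ _ _ ih₁ ih₂ ih₃ => exact .ite hΓ ih₁ ih₂ ih₃
  | letL hΓ hf _ ih => exact .letp hΓ hf ih
  | letR hΓ _ he ih => exact .letp hΓ ih he
  | choice hΓ _ _ ih₁ ih₂ => exact .choice hΓ ih₁ ih₂

/-- Related terms remain related under the same linear substitution. -/
theorem subst {k : Kind} {Γ : TyCtx} {t t' : Tm k} {A : Ty} (h : Rel r Γ t t' A) :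
    ∀ {σ : ℕ → Val} {Δ : TyCtx}, SubstTy r σ Γ Δ → Rel r Δ (t.subst σ) (t'.subst σ) A := by
  induction h with
  | refl ht => exact fun hσ => .refl (ht.subst hσ)
  | sim he hf h => exact fun hσ => .sim (he.subst hσ) (hf.subst hσ) (h.subst hσ)
  | valSim hΓ h =>
    intro σ Δ hσ
    subst hΓ
    have := h
    obtain ⟨hv, hw, _⟩ := this
    rw [hv.subst_closed, hw.subst_closed]
    exact .valSim (hσ.eq_empty fun n A hn => by cases hn) h
  | lam _ ih => exact fun hσ => .lam (ih (hσ.lift _))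
  | pairL hΓ _ hw ih =>
    intro σ Δ hσ
    obtain ⟨Δ₁, Δ₂, hΔ, h₁, h₂⟩ := hσ.exists_split hΓ
    exact .pairL hΔ (ih h₁) (hw.subst h₂)
  | pairR hΓ hv _ ih =>
    intro σ Δ hσ
    obtain ⟨Δ₁, Δ₂, hΔ, h₁, h₂⟩ := hσ.exists_split hΓ
    exact .pairR hΔ (hv.subst h₁) (ih h₂)
  | ret _ ih => exact fun hσ => .ret (ih hσ)
  | appL hΓ _ hf ih =>
    intro σ Δ hσ
    obtain ⟨Δ₁, Δ₂, hΔ, h₁, h₂⟩ := hσ.exists_split hΓ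
    exact .appL hΔ (ih h₁) (hf.subst h₂)
  | appR hΓ he _ ih =>
    intro σ Δ hσ
    obtain ⟨Δ₁, Δ₂, hΔ, h₁, h₂⟩ := hσ.exists_split hΓ
    exact .appR hΔ (he.subst h₁) (ih h₂)
  | ite hΓ _ _ _ ih₁ ih₂ ih₃ =>
    intro σ Δ hσ
    obtain ⟨Δ₁, Δ₂, hΔ, h₁, h₂⟩ := hσ.exists_split hΓ
    exact .ite hΔ (ih₁ h₁) (ih₂ h₂) (ih₃ h₂)
  | letL hΓ hf _ ih =>
    intro σ Δ hσ
    obtain ⟨Δ₁, Δ₂, hΔ, h₁, h₂⟩ := hσ.exists_split hΓ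
    exact .letL hΔ (hf.subst ((h₁.lift _).lift _)) (ih h₂)
  | letR hΓ _ he ih =>
    intro σ Δ hσ
    obtain ⟨Δ₁, Δ₂, hΔ, h₁, h₂⟩ := hσ.exists_split hΓ
    exact .letR hΔ (ih ((h₁.lift _).lift _)) (he.subst h₂)
  | choice hΓ _ _ ih₁ ih₂ =>
    intro σ Δ hσ
    obtain ⟨Δ₁, Δ₂, hΔ, h₁, h₂⟩ := hσ.exists_splits hΓ
    exact .choice hΔ (ih₁ h₁) (ih₂ h₂)

/-- `σ` and `τ` agree on the variables of `Γ`, except for one, which they send to related closed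
values. -/
structure DiffAt (r : ChoiceRule) (x : ℕ) (X : Ty) (σ τ : ℕ → Val) (Γ : TyCtx) : Prop where
  mem : Γ x = some X
  eq : ∀ n A, Γ n = some A → n ≠ x → σ n = τ n
  rel : Rel r TyCtx.empty (σ x) (τ x) X

namespace DiffAt

variable {x : ℕ} {X : Ty} {σ τ : ℕ → Val} {Γ Γ' : TyCtx}

theorem lift (h : DiffAt r x X σ τ Γ) (A : Ty) :
    DiffAt r (x + 1) X (liftSub σ) (liftSub τ) (Γ.cons A) where
  mem := h.mem
  eq n B hn hne := by
    cases n with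
    | zero => rfl
    | succ n => exact congrArg _ (h.eq n B hn fun he => hne (congrArg _ he))
  rel := by simpa only [liftSub, h.rel.left.rename_closed, h.rel.right.rename_closed] using h.rel

theorem mono (h : DiffAt r x X σ τ Γ) (hΓ : ∀ n A, Γ' n = some A → Γ n = some A)
    (hx : Γ' x = some X) : DiffAt r x X σ τ Γ' :=
  ⟨hx, fun n A hn => h.eq n A (hΓ n A hn), h.rel⟩

theorem agreeOn (h : DiffAt r x X σ τ Γ) (hΓ : ∀ n A, Γ' n = some A → Γ n = some A)
    (hx : Γ' x = none) : AgreeOn Γ' σ τ :=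
  fun n A hn => h.eq n A (hΓ n A hn) fun he => by simp [he, hx] at hn

/-- Linearity enters here: the distinguished variable belongs to exactly one part of a split. -/
theorem cases_split (h : DiffAt r x X σ τ Γ) {Γ₁ Γ₂ : TyCtx} (hΓ : Γ.Split Γ₁ Γ₂) :
    (DiffAt r x X σ τ Γ₁ ∧ AgreeOn Γ₂ σ τ) ∨ (DiffAt r x X σ τ Γ₂ ∧ AgreeOn Γ₁ σ τ) := by
  rcases hΓ.mem_or h.mem with ⟨h₁, h₂⟩ | ⟨h₂, h₁⟩
  · exact .inl ⟨h.mono (fun _ _ => hΓ.left_eq) h₁, h.agreeOn (fun _ _ => hΓ.right_eq) h₂⟩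
  · exact .inr ⟨h.mono (fun _ _ => hΓ.right_eq) h₂, h.agreeOn (fun _ _ => hΓ.left_eq) h₁⟩

end DiffAt

theorem of_agreeOn {k : Kind} {Γ Δ : TyCtx} {t : Tm k} {A : Ty} (ht : HasType r Γ t A)
    {σ τ : ℕ → Val} (hσ : SubstTy r σ Γ Δ) (h : AgreeOn Γ σ τ) :
    Rel r Δ (t.subst σ) (t.subst τ) A := by
  rw [← ht.subst_congr h]
  exact .refl (ht.subst hσ)

/-- A typed term yields related terms when related closed values are substituted for one of its
variables. -/
theorem of_diffAt {k : Kind} {Γ : TyCtx} {t : Tm k} {A : Ty} (ht : HasType r Γ t A) :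
    ∀ {x : ℕ} {X : Ty} {σ τ : ℕ → Val} {Δ : TyCtx}, SubstTy r σ Γ Δ → DiffAt r x X σ τ Γ →
      Rel r Δ (t.subst σ) (t.subst τ) A := by
  induction ht with
  | @var Γ n A hΓ =>
    intro x X σ τ Δ hσ h
    subst hΓ
    have hx := h.mem
    unfold TyCtx.single at hx
    split_ifs at hx with hxn
    subst hxn
    cases hx
    -- The value substituted for `x` is closed, which excludes the case of a variable and leaves `Δ`
    -- empty.
    rcases hσ.single_cases with ⟨_, rfl⟩ | ⟨m, hm, _⟩
    · exact h.rel
    · exact absurd (hm ▸ h.rel.left) not_hasType_empty_var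
  | bool hΓ =>
    intro x X σ τ Δ _ h
    subst hΓ
    cases h.mem
  | lam _ ih => exact fun hσ h => .lam (ih (hσ.lift _) (h.lift _))
  | pair hΓ hv hw ih₁ ih₂ =>
    intro x X σ τ Δ hσ h
    obtain ⟨Δ₁, Δ₂, hΔ, h₁, h₂⟩ := hσ.exists_split hΓ
    rcases h.cases_split hΓ with ⟨hd, ha⟩ | ⟨hd, ha⟩
    · simp only [Tm.subst, ← hw.subst_congr ha]
      exact .pairL hΔ (ih₁ h₁ hd) (hw.subst h₂)
    · simp only [Tm.subst, ← hv.subst_congr ha]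
      exact .pairR hΔ (hv.subst h₁) (ih₂ h₂ hd)
  | ret _ ih => exact fun hσ h => .ret (ih hσ h)
  | app hΓ he hf ih₁ ih₂ =>
    intro x X σ τ Δ hσ h
    obtain ⟨Δ₁, Δ₂, hΔ, h₁, h₂⟩ := hσ.exists_split hΓ
    rcases h.cases_split hΓ with ⟨hd, ha⟩ | ⟨hd, ha⟩
    · simp only [Tm.subst, ← hf.subst_congr ha]
      exact .appL hΔ (ih₁ h₁ hd) (hf.subst h₂)
    · simp only [Tm.subst, ← he.subst_congr ha]
      exact .appR hΔ (he.subst h₁) (ih₂ h₂ hd)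
  | ite hΓ he hf hg ih₁ ih₂ ih₃ =>
    intro x X σ τ Δ hσ h
    obtain ⟨Δ₁, Δ₂, hΔ, h₁, h₂⟩ := hσ.exists_split hΓ
    rcases h.cases_split hΓ with ⟨hd, ha⟩ | ⟨hd, ha⟩
    · exact .ite hΔ (ih₁ h₁ hd) (of_agreeOn hf h₂ ha) (of_agreeOn hg h₂ ha)
    -- The branches share their context, so both change at once.
    · exact .ite hΔ (of_agreeOn he h₁ ha) (ih₂ h₂ hd) (ih₃ h₂ hd)
  | letp hΓ hf he ih₁ ih₂ =>
    intro x X σ τ Δ hσ h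
    obtain ⟨Δ₁, Δ₂, hΔ, h₁, h₂⟩ := hσ.exists_split hΓ
    rcases h.cases_split hΓ with ⟨hd, ha⟩ | ⟨hd, ha⟩
    · simp only [Tm.subst, ← he.subst_congr ha]
      exact .letR hΔ (ih₁ ((h₁.lift _).lift _) ((hd.lift _).lift _)) (he.subst h₂)
    · simp only [Tm.subst, ← hf.subst_congr ((ha.lift _).lift _)]
      exact .letL hΔ (hf.subst ((h₁.lift _).lift _)) (ih₂ h₂ hd)
  -- `omega` may absorb the distinguished variable, but no substitution changes it.
  | omega hΓ => exact fun hσ _ => .refl (.omega (hσ.dom_finite hΓ))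
  | choice hΓ he hf ih₁ ih₂ =>
    intro x X σ τ Δ hσ h
    obtain ⟨Δ₁, Δ₂, hΔ, h₁, h₂⟩ := hσ.exists_splits hΓ
    cases r with
    | additive =>
      obtain ⟨rfl, rfl⟩ := hΓ
      exact .choice hΔ (ih₁ h₁ h) (ih₂ h₂ h)
    | multiplicative =>
      rcases h.cases_split hΓ with ⟨hd, ha⟩ | ⟨hd, ha⟩
      · exact .choice hΔ (ih₁ h₁ hd) (of_agreeOn hf h₂ ha)
      · exact .choice hΔ (of_agreeOn he h₁ ha) (ih₂ h₂ hd)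

end Rel

/-! ### Evaluation preserves the closure -/

theorem Dist.expect_eq_sum {E : Dist} {s : Finset Val} (hs : E.support ⊆ s) (φ : Val → ℝ≥0) :
    E.expect φ = ∑ u ∈ s, E u * φ u :=
  Finsupp.sum_of_support_subset E hs _ fun _ _ => zero_mul _

/-- The expectation of `φ` under the semantics of a conditional. -/
theorem Dist.expect_ite (E F G : Dist) (φ : Val → ℝ≥0) :
    (E (.bool true) • F + E (.bool false) • G).expect φ = E.expect fun u =>
      match u with
      | .bool true => F.expect φ
      | .bool false => G.expect φ
      | _ => 0 := by
  classical
  rw [expect_add, expect_smul, expect_smul]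
  have hne : (Tm.bool true : Val) ≠ Tm.bool false := by simp
  -- The booleans may lie outside the support of `E`, so the sum is first enlarged by them and then
  -- cut down to them.
  rw [expect_eq_sum (E := E) (Finset.subset_union_left (s₂ := {Tm.bool true, Tm.bool false})),
    ← Finset.sum_subset Finset.subset_union_right, Finset.sum_pair hne]
  intro u _ hu
  rcases u with _ | (_ | _) | _ | _ <;> simp at hu ⊢

namespace Rel

variable {r : ChoiceRule}

/-- The relation between closed values of type `A`. -/
abbrev Closed (r : ChoiceRule) (A : Ty) (u v : Val) : Prop := Rel r TyCtx.empty u v A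

theorem eq_of_bool {u v : Val} (h : Closed r .bool u v) : u = v := by
  cases h with
  | refl _ => rfl
  | valSim _ h => exact h.eq_of_bool

theorem subst1_left {s s' : Trm} {w : Val} {A B : Ty}
    (h : Closed r (.lolli A B) (.lam s) (.lam s')) (hw : HasType r TyCtx.empty w A) :
    Rel r TyCtx.empty (s.subst1 w) (s'.subst1 w) B := by
  cases h with
  | refl ht => exact .refl (ht.lam_inv.subst1 hw)
  | valSim _ h =>
    exact .sim (h.1.lam_inv.subst1 hw) (h.2.1.lam_inv.subst1 hw) (h.subst1 hw)
  | lam he => exact he.subst (.of_closes (closes_consSub (closes_empty r _) hw))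

theorem subst1_right {s : Trm} {w w' : Val} {A B : Ty}
    (hs : HasType r TyCtx.empty (.lam s) (.lolli A B)) (h : Closed r A w w') :
    Rel r TyCtx.empty (s.subst1 w) (s.subst1 w') B := by
  refine of_diffAt (x := 0) (X := A) hs.lam_inv
    (.of_closes (closes_consSub (closes_empty r _) h.left)) ⟨rfl, fun n B hn hne => ?_, h⟩
  cases n with
  | zero => exact absurd rfl hne
  | succ n => cases hn

theorem subst2_left {s s' : Trm} {v w : Val} {A B C : Ty}
    (h : Rel r ((TyCtx.empty.cons A).cons B) s s' C) (hv : HasType r TyCtx.empty v A)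
    (hw : HasType r TyCtx.empty w B) :
    Rel r TyCtx.empty (s.subst2 v w) (s'.subst2 v w) C :=
  h.subst (.of_closes (closes_consSub (closes_consSub (closes_empty r _) hv) hw))

/-- The one-sided pair rules leave a single variable whose value changes, so `of_diffAt` applies;
similar pairs are handled by the test label `s`. -/
theorem subst2_right {s : Trm} {v w v' w' : Val} {A B C : Ty}
    (hs : HasType r ((TyCtx.empty.cons A).cons B) s C)
    (h : Closed r (.tensor A B) (.pair v w) (.pair v' w')) :
    Rel r TyCtx.empty (s.subst2 v w) (s.subst2 v' w') C := by
  have hl := h.left.pair_inv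
  have hσ : SubstTy r (consSub w (consSub v Tm.var)) ((TyCtx.empty.cons A).cons B) TyCtx.empty :=
    .of_closes (closes_consSub (closes_consSub (closes_empty r _) hl.1) hl.2)
  have hr := h.right.pair_inv
  cases h with
  | refl _ => exact .refl (hs.subst hσ)
  | valSim _ h => exact .sim (hs.subst2 hl.1 hl.2) (hs.subst2 hr.1 hr.2) (h.subst2 hs)
  | pairL hΓ h _ =>
    rw [hΓ.left_of_empty] at h
    refine of_diffAt (x := 1) (X := A) hs hσ ⟨rfl, fun n B hn hne => ?_, h⟩
    rcases n with _ | _ | n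
    · rfl
    · exact absurd rfl hne
    · cases hn
  | pairR hΓ _ h =>
    rw [hΓ.right_of_empty] at h
    refine of_diffAt (x := 0) (X := B) hs hσ ⟨rfl, fun n B hn hne => ?_, h⟩
    rcases n with _ | _ | n
    · exact absurd rfl hne
    · rfl
    · cases hn

theorem lift_refl {e : Trm} {A : Ty} {E E' : Dist} (he : HasType r TyCtx.empty e A)
    (hE : BigStep e E) (hE' : BigStep e E') : E.Lift (Closed r A) E' := by
  rw [← hE.unique hE']
  exact .refl fun u hu => .refl (hE.preservation he u hu)

theorem lift_sim {e e' : Trm} {A : Ty} {E E' : Dist} (h : AppSim r TyCtx.empty A e e')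
    (hE : BigStep e E) (hE' : BigStep e' E') : E.Lift (Closed r A) E' := by
  rw [← hE.sem_eq, ← hE'.sem_eq]
  exact h.lift_valSim.mono fun u v huv => .valSim rfl huv

/-- Evaluation takes related closed terms to related distributions. -/
theorem lift {e : Trm} {E : Dist} (hE : BigStep e E) : ∀ {e' : Trm} {A : Ty} {E' : Dist},
    Rel r TyCtx.empty e e' A → BigStep e' E' → E.Lift (Closed r A) E' := by
  -- The induction is on the derivation for the left term, as the premises for `s{w/x}` do not
  -- concern subterms; the evaluation of the right term is inverted in each case.
  induction hE with
  | ret v =>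
    intro e' A E' h hE'
    cases h with
    | refl ht => exact lift_refl ht (.ret v) hE'
    | sim _ _ h => exact lift_sim h (.ret v) hE'
    | ret hv =>
      cases hE'
      exact .single hv
  | omega => exact fun _ _ _ _ _ => zero_le
  | @app e f E F G hE hF hG ihE ihF ihG =>
    intro e' A E' h hE'
    cases h with
    | refl ht => exact lift_refl ht (.app hE hF hG) hE'
    | sim _ _ h => exact lift_sim h (.app hE hF hG) hE'
    | appL hΓ he hf =>
      rw [hΓ.left_of_empty] at he
      rw [hΓ.right_of_empty] at hf
      cases hE' with
      | @app _ _ E' F' G' hE' hF' hG' =>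
        -- The unchanged argument has the same distribution on both sides, so the bodies are
        -- compared at the same `w`.
        obtain rfl := hF.unique hF'
        intro φ ψ hφ
        rw [Dist.expect_appDist, Dist.expect_appDist]
        -- Restriction to the supports is essential: only there do the evaluation rules provide
        -- derivations for the instantiated bodies.
        refine (ihE he hE').expect_le fun u hu v hv huv => ?_
        obtain ⟨s, rfl⟩ := huv.left.eq_lam
        obtain ⟨s', rfl⟩ := huv.right.eq_lam
        exact Dist.expect_mono fun w hw => ihG s w hu hw
          (huv.subst1_left (hF.preservation hf w hw)) (hG' s' w hv hw) φ ψ hφ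
    | appR hΓ he hf =>
      rw [hΓ.left_of_empty] at he
      rw [hΓ.right_of_empty] at hf
      cases hE' with
      | @app _ _ E' F' G' hE' hF' hG' =>
        obtain rfl := hE.unique hE'
        intro φ ψ hφ
        rw [Dist.expect_appDist, Dist.expect_appDist]
        refine Dist.expect_mono fun u hu => ?_
        have htu := hE.preservation he u hu
        obtain ⟨s, rfl⟩ := htu.eq_lam
        -- For a fixed function `λx.s`, the expectations of the bodies are test functions of the
        -- argument.
        exact (ihF hf hF').expect_le fun w hw w' hw' hww => ihG s w hu hw
          (subst1_right htu hww) (hG' s w' hu hw') φ ψ hφ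
  | @ite e f g E F G hE hF hG ihE ihF ihG =>
    intro e' A E' h hE'
    cases h with
    | refl ht => exact lift_refl ht (.ite hE hF hG) hE'
    | sim _ _ h => exact lift_sim h (.ite hE hF hG) hE'
    | ite hΓ he hf hg =>
      rw [hΓ.left_of_empty] at he
      rw [hΓ.right_of_empty] at hf hg
      cases hE' with
      | @ite _ _ _ E' F' G' hE' hF' hG' =>
        intro φ ψ hφ
        rw [Dist.expect_ite, Dist.expect_ite]
        refine (ihE he hE').expect_le fun u _ v _ huv => ?_
        -- Related booleans are equal, so both sides take the same branch; this is why guard and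
        -- branches may change together.
        obtain rfl := huv.eq_of_bool
        obtain ⟨b, rfl⟩ := huv.left.eq_bool
        cases b with
        | false => exact ihG hg hG' φ ψ hφ
        | true => exact ihF hf hF' φ ψ hφ
  | @letp e f E G hE hG ihE ihG =>
    intro e' A E' h hE'
    cases h with
    | refl ht => exact lift_refl ht (.letp hE hG) hE'
    | sim _ _ h => exact lift_sim h (.letp hE hG) hE'
    | letL hΓ hf he =>
      rw [hΓ.left_of_empty] at hf
      rw [hΓ.right_of_empty] at he
      cases hE' with
      | @letp _ _ E' G' hE' hG' =>
        intro φ ψ hφ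
        rw [Dist.expect_letDist, Dist.expect_letDist]
        refine (ihE he hE').expect_le fun u hu v hv huv => ?_
        obtain ⟨u₁, u₂, rfl⟩ := huv.left.eq_pair
        obtain ⟨v₁, v₂, rfl⟩ := huv.right.eq_pair
        exact ihG u₁ u₂ hu (subst2_right hf huv) (hG' v₁ v₂ hv) φ ψ hφ
    | letR hΓ hf he =>
      rw [hΓ.left_of_empty] at hf
      rw [hΓ.right_of_empty] at he
      cases hE' with
      | @letp _ _ E' G' hE' hG' =>
        obtain rfl := hE.unique hE'
        intro φ ψ hφ
        rw [Dist.expect_letDist, Dist.expect_letDist]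
        refine Dist.expect_mono fun u hu => ?_
        have htu := hE.preservation he u hu
        obtain ⟨u₁, u₂, rfl⟩ := htu.eq_pair
        exact ihG u₁ u₂ hu (subst2_left hf htu.pair_inv.1 htu.pair_inv.2) (hG' u₁ u₂ hu) φ ψ hφ
  | choice hE hF ihE ihF =>
    intro e' A E' h hE'
    cases h with
    | refl ht => exact lift_refl ht (.choice hE hF) hE'
    | sim _ _ h => exact lift_sim h (.choice hE hF) hE'
    | choice hΓ he hf =>
      rw [hΓ.of_empty.1] at he
      rw [hΓ.of_empty.2] at hf
      cases hE' with
      | choice hE' hF' =>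
        intro φ ψ hφ
        simp only [Dist.expect_add, Dist.expect_smul]
        exact add_le_add (mul_le_mul_right (ihE he hE' φ ψ hφ) _)
          (mul_le_mul_right (ihF hf hF' φ ψ hφ) _)

theorem probConv_le {e e' : Trm} {A : Ty} (h : Rel r TyCtx.empty e e' A) :
    probConv e ≤ probConv e' := by
  have := h.lift h.left.bigStep_sem h.right.bigStep_sem (fun _ => 1) (fun _ => 1)
    fun _ _ _ => le_rfl
  rwa [Dist.expect_one, Dist.expect_one] at this

/-- Filling the hole of a typed context with similar terms yields related terms. -/
theorem fill {k : Kind} {Γ Δ : TyCtx} {A B : Ty} {C : Context k} (hC : CtxHasType r Δ A Γ C B)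
    {e f : Trm} (he : HasType r Δ e A) (hf : HasType r Δ f A) (h : AppSim r Δ A e f) :
    Rel r Γ (C.fill e) (C.fill f) B := by
  induction hC with
  | hole hΓ =>
    simp only [Context.fill, Tm.rename_eq_subst]
    -- Plugging the hole is a linear substitution of variables for variables, so similarity of open
    -- terms survives capture.
    exact .subst (.sim he hf h) (.of_renames hΓ)
  | lam _ ih => exact .lam ih
  | pairL hΓ _ hw ih => exact .pairL hΓ ih hw
  | pairR hΓ hv _ ih => exact .pairR hΓ hv ih
  | ret _ ih => exact .ret ih
  | appL hΓ _ hf ih => exact .appL hΓ ih hf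
  | appR hΓ he _ ih => exact .appR hΓ he ih
  | iteC hΓ _ hf hg ih => exact .ite hΓ ih (.refl hf) (.refl hg)
  | iteT hΓ he _ hg ih => exact .ite hΓ (.refl he) ih (.refl hg)
  | iteF hΓ he hf _ ih => exact .ite hΓ (.refl he) (.refl hf) ih
  | letL hΓ hf _ ih => exact .letL hΓ hf ih
  | letR hΓ _ he ih => exact .letR hΓ ih he
  | choiceL hΓ _ hf ih => exact .choice hΓ ih (.refl hf)
  | choiceR hΓ he _ ih => exact .choice hΓ (.refl he) ih

end Rel

theorem AppSim.ctxPreorder {r : ChoiceRule} {Γ : TyCtx} {A : Ty} {e f : Trm}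
    (he : HasType r Γ e A) (hf : HasType r Γ f A) (h : AppSim r Γ A e f) :
    CtxPreorder r Γ A e f :=
  fun _ _ hC => (Rel.fill hC he hf h).probConv_le

theorem AppBisim.appSim {r : ChoiceRule} {Γ : TyCtx} {A : Ty} {e f : Trm}
    (h : AppBisim r Γ A e f) : AppSim r Γ A e f := fun σ hσ =>
  let ⟨he, hf, hs⟩ := h σ hσ
  ⟨he, hf, hs.similar⟩

theorem AppBisim.symm {r : ChoiceRule} {Γ : TyCtx} {A : Ty} {e f : Trm}
    (h : AppBisim r Γ A e f) : AppBisim r Γ A f e := fun σ hσ =>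
  let ⟨he, hf, hs⟩ := h σ hσ
  ⟨hf, he, hs.symm⟩

end LPST

theorem theorem2 (r : LPST.ChoiceRule) :
    (∀ (Γ : LPST.TyCtx) (A : LPST.Ty) (e f : LPST.Trm),
      LPST.HasType r Γ e A → LPST.HasType r Γ f A →
        LPST.AppSim r Γ A e f → LPST.CtxPreorder r Γ A e f) ∧
    (∀ (Γ : LPST.TyCtx) (A : LPST.Ty) (e f : LPST.Trm),
      LPST.HasType r Γ e A → LPST.HasType r Γ f A →
        LPST.AppBisim r Γ A e f → LPST.CtxEquiv r Γ A e f) :=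
  ⟨fun _ _ _ _ he hf h => h.ctxPreorder he hf, fun _ _ _ _ he hf h =>
    ⟨h.appSim.ctxPreorder he hf, h.symm.appSim.ctxPreorder hf he⟩⟩
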